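/- Let $A$ be a (not necessarily unital) $C^*$-algebra, $\mathcal H$ a Hilbert space and $\phi:A\to\mathbf B(\mathcal H)$ a completely positive linear map. Let $\mathcal H_0$ be a separable infinite-dimensional Hilbert space, let $\mathbf K$ be the $C^*$-algebra of compact operators on $\mathcal H_0$, and let $A\otimes\mathbf K$ be the $C^*$-tensor product. Then there is a unique completely positive linear map $\phi\otimes\mathrm{id}_{\mathbf K}:A\otimes\mathbf K\to\mathbf B(\mathcal H\otimes\mathcal H_0)$ with $(\phi\otimes\mathrm{id}_{\mathbf K})(a\otimes k)=\phi(a)\otimes k$ for all $a\in A$, $k\in\mathbf K$, and $\phi$ is strongly Morita equivalent to $\phi\otimes\mathrm{id}_{\mathbf K}$ in the following sense. A minimal Stinespring representation of a completely positive linear map $\psi:B\to\mathbf B(\mathcal L)$, where $B$ is a $C^*$-algebra and $\mathcal L$ is a Hilbert space, consists of a Hilbert space $\mathcal H_\psi$, a representation ($*$-homomorphism) $\pi_\psi:B\to\mathbf B(\mathcal H_\psi)$ and $V_\psi\in\mathbf B(\mathcal L,\mathcal H_\psi)$ with $\psi(b)=V_\psi^*\pi_\psi(b)V_\psi$ for all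 $b\in B$, $\|V_\psi\|^2=\|\psi\|$, and $\mathcal H_\psi$ the closed linear span of $\pi_\psi(B)V_\psi\mathcal L$. Two non-degenerate representations $\pi_A:A\to\mathbf B(\mathcal H_1)$ and $\pi_B:B\to\mathbf B(\mathcal H_2)$ of $C^*$-algebras $A$, $B$ are strongly Morita equivalent if there are an $A$-$B$-equivalence (imprimitivity) bimodule $X$ and a linear map $\pi_X:X\to\mathbf B(\mathcal H_2,\mathcal H_1)$ such that, for all $a\in A$, $b\in B$, $x,y\in X$, $$\pi_X(x)\pi_X(y)^*=\pi_A({}_A\langle x,y\rangle),\qquad \pi_X(x)^*\pi_X(y)=\pi_B(\langle x,y\rangle_B),\qquad \pi_X(a\cdot x\cdot b)=\pi_A(a)\pi_X(x)\pi_B(b).$$ Two completely positive linear maps are strongly Morita equivalent if a minimal Stinespring representation of the first is strongly Morita equivalent to a minimal Stinespring representation of the second. -/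

import Mathlib

open scoped TensorProduct CStarAlgebra InnerProductSpace

universe u v u' v' w

noncomputable section

/-! ### The C⋆-algebra of compact operators on a Hilbert space -/

section Compact

variable (H : Type*) [NormedAddCommGroup H] [InnerProductSpace ℂ H] [CompleteSpace H]

variable {H} in
theorem isCompactOperator_star {T : H →L[ℂ] H} (hT : IsCompactOperator T) :
    IsCompactOperator (star T : H →L[ℂ] H) := by
  have hTT : IsCompactOperator (T * star T : H →L[ℂ] H) := hT.comp_clm (star T)
  have key : ∀ x y : H, ‖(star T) x - (star T) y‖ ^ 2
      ≤ ‖x - y‖ * ‖(T * star T) x - (T * star T) y‖ := by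
    intro x y
    rw [← map_sub, ← map_sub, ← inner_self_eq_norm_sq (𝕜 := ℂ), ContinuousLinearMap.star_eq_adjoint,
      ContinuousLinearMap.adjoint_inner_left]
    exact (RCLike.re_le_norm _).trans (norm_inner_le_norm _ _)
  refine (isCompactOperator_iff_isCompact_closure_image_closedBall
    ((star T : H →L[ℂ] H) : H →ₗ[ℂ] H) one_pos).2 ?_
  refine TotallyBounded.isCompact_of_isClosed ?_ isClosed_closure
  refine TotallyBounded.closure ?_
  have htb : TotallyBounded ((T * star T : H →L[ℂ] H) '' Metric.closedBall 0 1) :=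
    (hTT.isCompact_closure_image_closedBall (f := ((T * star T : H →L[ℂ] H) : H →ₗ[ℂ] H))
      1).totallyBounded.subset subset_closure
  rw [Metric.totallyBounded_iff] at htb ⊢
  intro ε hε
  obtain ⟨t, hts, htf, hcov⟩ := totallyBounded_iff_subset.1
    (Metric.totallyBounded_iff.2 htb) _ (Metric.dist_mem_uniformity (show 0 < ε ^ 2 / 4 by positivity))
  have hts' : ∀ z ∈ t, ∃ x ∈ Metric.closedBall (0 : H) 1, (T * star T) x = z :=
    fun z hz => hts hz
  choose! g hg using hts'
  refine ⟨(fun z => (star T) (g z)) '' t, htf.image _, ?_⟩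
  rintro _ ⟨x, hx, rfl⟩
  have := hcov ⟨x, hx, rfl⟩
  simp only [Set.mem_iUnion] at this ⊢
  obtain ⟨z, hz, hxz⟩ := this
  refine ⟨_, ⟨z, hz, rfl⟩, ?_⟩
  obtain ⟨hg1, hg2⟩ := hg z hz
  have hd : ‖(T * star T) x - (T * star T) (g z)‖ < ε ^ 2 / 4 := by
    rw [hg2, ← dist_eq_norm]; exact hxz
  have hn : ‖x - g z‖ ≤ 2 := by
    have h1 : ‖x‖ ≤ 1 := by simpa using hx
    have h2 : ‖g z‖ ≤ 1 := by simpa using hg1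
    exact (norm_sub_le _ _).trans (by linarith)
  have h3 := key x (g z)
  rw [Metric.mem_ball, dist_eq_norm]
  refine lt_of_pow_lt_pow_left₀ 2 hε.le (h3.trans_lt ?_)
  nlinarith [norm_nonneg (x - g z), norm_nonneg ((T * star T) x - (T * star T) (g z))]

/-- The algebra `𝐊(H)` of all compact operators on the Hilbert space `H`. -/
def compactOperators : NonUnitalStarSubalgebra ℂ (H →L[ℂ] H) where
  carrier := {T | IsCompactOperator T}
  add_mem' := fun ha hb => ha.add hb
  zero_mem' := isCompactOperator_zero
  mul_mem' := fun {_ b} ha _ => ha.comp_clm b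
  smul_mem' := fun c _ ha => ha.smul c
  star_mem' := isCompactOperator_star

instance compactOperators_isClosed :
    IsClosed (compactOperators H : Set (H →L[ℂ] H)) :=
  isClosed_setOfPred_isCompactOperator

instance compactOperators_nonUnitalCStarAlgebra : NonUnitalCStarAlgebra (compactOperators H) :=
  NonUnitalStarSubalgebra.nonUnitalCStarAlgebra (compactOperators H)

end Compact

/-! ### The C⋆-tensor product of two C⋆-algebras

The completion of the algebraic tensor product in its greatest C⋆-norm.  When one of the
factors is nuclear, as is the case for the algebra of compact operators, the algebraic tensor
product carries exactly one C⋆-norm, so that this is *the* C⋆-tensor product. -/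

section Tensor

variable (A B : Type*) [NonUnitalCStarAlgebra A] [NonUnitalCStarAlgebra B]

/-- The algebraic tensor product (a type synonym, which receives the C⋆-norm). -/
def AlgTensor : Type _ := A ⊗[ℂ] B

namespace AlgTensor

instance instNonUnitalRing : NonUnitalRing (AlgTensor A B) :=
  inferInstanceAs (NonUnitalRing (A ⊗[ℂ] B))

instance instModule : Module ℂ (AlgTensor A B) :=
  inferInstanceAs (Module ℂ (A ⊗[ℂ] B))

instance instIsScalarTower : IsScalarTower ℂ (AlgTensor A B) (AlgTensor A B) :=
  inferInstanceAs (IsScalarTower ℂ (A ⊗[ℂ] B) (A ⊗[ℂ] B))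

instance instSMulCommClass : SMulCommClass ℂ (AlgTensor A B) (AlgTensor A B) :=
  inferInstanceAs (SMulCommClass ℂ (A ⊗[ℂ] B) (A ⊗[ℂ] B))

instance instStarAddMonoid : StarAddMonoid (AlgTensor A B) :=
  inferInstanceAs (StarAddMonoid (A ⊗[ℂ] B))

instance instStarModule : StarModule ℂ (AlgTensor A B) :=
  inferInstanceAs (StarModule ℂ (A ⊗[ℂ] B))

variable {A B}

/-- The elementary tensor `a ⊗ b`. -/
def tmul (a : A) (b : B) : AlgTensor A B := a ⊗ₜ[ℂ] b

theorem tmul_mul_tmul (a a' : A) (b b' : B) :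
    tmul a b * tmul a' b' = tmul (a * a') (b * b') :=
  Algebra.TensorProduct.tmul_mul_tmul a a' b b'

theorem star_tmul (a : A) (b : B) : star (tmul a b) = tmul (star a) (star b) := rfl

theorem induction_on {p : AlgTensor A B → Prop} (z : AlgTensor A B) (zero : p 0)
    (tmul : ∀ a b, p (tmul a b)) (add : ∀ x y, p x → p y → p (x + y)) : p z :=
  TensorProduct.induction_on (motive := p) z zero tmul add

instance instStarRing : StarRing (AlgTensor A B) where
  star_add := star_add
  star_mul x y := by
    induction x using induction_on with
    | zero => simp
    | add x x' hx hx' => rw [add_mul, star_add, hx, hx', star_add, mul_add]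
    | tmul a b =>
      induction y using induction_on with
      | zero => simp
      | add y y' hy hy' => rw [mul_add, star_add, hy, hy', star_add, add_mul]
      | tmul a' b' => simp only [tmul_mul_tmul, star_tmul, star_mul]

/-- C⋆-seminorms on the algebraic tensor product.  The last condition is automatic; it is
recorded because it shows at once that the supremum over all C⋆-seminorms is finite. -/
structure IsCStarSeminorm (p : Seminorm ℂ (AlgTensor A B)) : Prop where
  mul_le : ∀ x y, p (x * y) ≤ p x * p y
  star_mul_self : ∀ x, p (star x * x) = p x ^ 2
  tmul_le : ∀ a b, p (tmul a b) ≤ ‖a‖ * ‖b‖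

variable (A B) in
/-- The type of all C⋆-seminorms on the algebraic tensor product. -/
abbrev CSeminorm : Type _ := {p : Seminorm ℂ (AlgTensor A B) // IsCStarSeminorm p}

instance : Nonempty (CSeminorm A B) :=
  ⟨⟨0, ⟨fun _ _ => by simp, fun _ => by simp, fun _ _ => by simp; positivity⟩⟩⟩

/-- The greatest C⋆-(semi)norm on the algebraic tensor product. -/
def maxNorm (x : AlgTensor A B) : ℝ := ⨆ p : CSeminorm A B, p.1 x

theorem bddAbove (x : AlgTensor A B) :
    BddAbove (Set.range fun p : CSeminorm A B => p.1 x) := by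
  induction x using induction_on with
  | zero => exact ⟨0, by rintro _ ⟨p, rfl⟩; simp⟩
  | tmul a b => exact ⟨‖a‖ * ‖b‖, by rintro _ ⟨p, rfl⟩; exact p.2.tmul_le a b⟩
  | add x y hx hy =>
    obtain ⟨c, hc⟩ := hx
    obtain ⟨d, hd⟩ := hy
    refine ⟨c + d, ?_⟩
    rintro _ ⟨p, rfl⟩
    exact (map_add_le_add p.1 x y).trans (add_le_add (hc ⟨p, rfl⟩) (hd ⟨p, rfl⟩))

theorem le_maxNorm (p : CSeminorm A B) (x : AlgTensor A B) : p.1 x ≤ maxNorm x :=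
  le_ciSup (bddAbove x) p

theorem maxNorm_nonneg (x : AlgTensor A B) : 0 ≤ maxNorm x :=
  Real.iSup_nonneg fun p => apply_nonneg p.1 x

theorem maxNorm_add_le (x y : AlgTensor A B) : maxNorm (x + y) ≤ maxNorm x + maxNorm y :=
  ciSup_le fun p => (map_add_le_add p.1 x y).trans (add_le_add (le_maxNorm p x) (le_maxNorm p y))

theorem maxNorm_smul (c : ℂ) (x : AlgTensor A B) : maxNorm (c • x) = ‖c‖ * maxNorm x := by
  simp only [maxNorm, map_smul_eq_mul]
  exact (Real.mul_iSup_of_nonneg (norm_nonneg c) _).symm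

theorem maxNorm_mul_le (x y : AlgTensor A B) : maxNorm (x * y) ≤ maxNorm x * maxNorm y :=
  ciSup_le fun p => (p.2.mul_le x y).trans
    (mul_le_mul (le_maxNorm p x) (le_maxNorm p y) (apply_nonneg p.1 y) (maxNorm_nonneg x))

theorem maxNorm_mul_self_le (x : AlgTensor A B) : maxNorm x * maxNorm x ≤ maxNorm (star x * x) := by
  have h : maxNorm x ≤ √(maxNorm (star x * x)) := by
    refine ciSup_le fun p => Real.le_sqrt_of_sq_le ?_
    rw [← p.2.star_mul_self x]
    exact le_maxNorm p _
  calc maxNorm x * maxNorm x ≤ √(maxNorm (star x * x)) * √(maxNorm (star x * x)) :=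
        mul_self_le_mul_self (maxNorm_nonneg x) h
    _ = _ := Real.mul_self_sqrt (maxNorm_nonneg _)

variable (A B) in
/-- The greatest C⋆-norm as a seminorm. -/
def maxSeminorm : Seminorm ℂ (AlgTensor A B) :=
  Seminorm.of maxNorm maxNorm_add_le maxNorm_smul

instance instNonUnitalSeminormedRing : NonUnitalSeminormedRing (AlgTensor A B) where
  __ := instNonUnitalRing A B
  __ := (maxSeminorm A B).toAddGroupSeminorm.toSeminormedAddCommGroup
  norm_mul_le := maxNorm_mul_le

theorem norm_def (x : AlgTensor A B) : ‖x‖ = maxNorm x := rfl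

instance instNormedSpace : NormedSpace ℂ (AlgTensor A B) where
  __ := instModule A B
  norm_smul_le c x := (maxNorm_smul c x).le

theorem norm_star_le (x : AlgTensor A B) : ‖star x‖ ≤ ‖x‖ := by
  have h1 : ‖star x‖ * ‖star x‖ ≤ ‖x‖ * ‖star x‖ := by
    have h := maxNorm_mul_self_le (star x)
    rw [star_star] at h
    exact h.trans (maxNorm_mul_le x (star x))
  by_contra hlt
  push Not at hlt
  nlinarith [norm_nonneg x]

instance instNormedStarGroup : NormedStarGroup (AlgTensor A B) where
  norm_star_le := norm_star_le

end AlgTensor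

open UniformSpace

/-- The C⋆-tensor product `A ⊗ B`: the completion of the algebraic tensor product. -/
def CStarTensor : Type _ := Completion (AlgTensor A B)

namespace CStarTensor

instance instNormedAddCommGroup : NormedAddCommGroup (CStarTensor A B) :=
  inferInstanceAs (NormedAddCommGroup (Completion (AlgTensor A B)))

instance instNormedSpace : NormedSpace ℂ (CStarTensor A B) :=
  inferInstanceAs (NormedSpace ℂ (Completion (AlgTensor A B)))

instance instCompleteSpace : CompleteSpace (CStarTensor A B) :=
  inferInstanceAs (CompleteSpace (Completion (AlgTensor A B)))

variable {A B}

/-- The canonical map from the algebraic tensor product. -/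
def of (x : AlgTensor A B) : CStarTensor A B := (x : Completion (AlgTensor A B))

theorem isDenseInducing_of : IsDenseInducing (of : AlgTensor A B → CStarTensor A B) :=
  Completion.isDenseInducing_coe

theorem norm_of (x : AlgTensor A B) : ‖of x‖ = ‖x‖ := Completion.norm_coe x

theorem continuous_of : Continuous (of : AlgTensor A B → CStarTensor A B) :=
  Completion.continuous_coe _

theorem of_add (x y : AlgTensor A B) : of (x + y) = of x + of y := Completion.coe_add x y

theorem of_smul (c : ℂ) (x : AlgTensor A B) : of (c • x) = c • of x := Completion.coe_smul c x

theorem of_zero : of (0 : AlgTensor A B) = 0 := Completion.coe_zero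

@[elab_as_elim]
theorem induction_on {p : CStarTensor A B → Prop} (x : CStarTensor A B)
    (hp : IsClosed {x | p x}) (ih : ∀ x, p (of x)) : p x :=
  Completion.induction_on x hp ih

@[elab_as_elim]
theorem induction_on₂ {p : CStarTensor A B → CStarTensor A B → Prop} (x y : CStarTensor A B)
    (hp : IsClosed {x : CStarTensor A B × CStarTensor A B | p x.1 x.2})
    (ih : ∀ x y, p (of x) (of y)) : p x y :=
  Completion.induction_on₂ x y hp ih

@[elab_as_elim]
theorem induction_on₃ {p : CStarTensor A B → CStarTensor A B → CStarTensor A B → Prop}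
    (x y z : CStarTensor A B)
    (hp : IsClosed {x : CStarTensor A B × CStarTensor A B × CStarTensor A B | p x.1 x.2.1 x.2.2})
    (ih : ∀ x y z, p (of x) (of y) (of z)) : p x y z :=
  Completion.induction_on₃ x y z hp ih

/-- Multiplication, extended by continuity. -/
instance instMul : Mul (CStarTensor A B) :=
  ⟨Function.curry <| (isDenseInducing_of.prodMap isDenseInducing_of).extend
    (of ∘ Function.uncurry (· * ·))⟩

theorem of_mul (x y : AlgTensor A B) : of (x * y) = of x * of y :=
  ((isDenseInducing_of.prodMap isDenseInducing_of).extend_eq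
    (continuous_of.comp (@continuous_mul (AlgTensor A B) _ _ _)) (x, y)).symm

instance instContinuousMul : ContinuousMul (CStarTensor A B) where
  continuous_mul := by
    let m := (AddMonoidHom.mul : AlgTensor A B →+ AlgTensor A B →+ AlgTensor A B).compr₂
      (Completion.toCompl : AlgTensor A B →+ Completion (AlgTensor A B))
    have : Continuous fun p : AlgTensor A B × AlgTensor A B => m p.1 p.2 :=
      (Completion.continuous_coe _).comp continuous_mul
    have di : IsDenseInducing
        (Completion.toCompl : AlgTensor A B → Completion (AlgTensor A B)) :=
      Completion.isDenseInducing_coe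
    exact (di.extend_Z_bilin di this :)

instance instNonUnitalRing : NonUnitalRing (CStarTensor A B) where
  __ := (inferInstance : AddCommGroup (CStarTensor A B))
  __ := (instMul : Mul (CStarTensor A B))
  zero_mul x := by
    refine induction_on x (isClosed_eq (by fun_prop) (by fun_prop)) fun a => ?_
    rw [← of_zero, ← of_mul, zero_mul]
  mul_zero x := by
    refine induction_on x (isClosed_eq (by fun_prop) (by fun_prop)) fun a => ?_
    rw [← of_zero, ← of_mul, mul_zero]
  mul_assoc x y z := by
    refine induction_on₃ x y z (isClosed_eq (by fun_prop) (by fun_prop)) fun a b c => ?_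
    simp only [← of_mul, mul_assoc]
  left_distrib x y z := by
    refine induction_on₃ x y z (isClosed_eq (by fun_prop) (by fun_prop)) fun a b c => ?_
    simp only [← of_mul, ← of_add, mul_add]
  right_distrib x y z := by
    refine induction_on₃ x y z (isClosed_eq (by fun_prop) (by fun_prop)) fun a b c => ?_
    simp only [← of_mul, ← of_add, add_mul]

instance instNonUnitalNormedRing : NonUnitalNormedRing (CStarTensor A B) where
  __ := (inferInstance : NormedAddCommGroup (CStarTensor A B))
  __ := (inferInstance : NonUnitalRing (CStarTensor A B))
  norm_mul_le x y := by
    refine induction_on₂ x y (isClosed_le (by fun_prop) (by fun_prop)) fun a b => ?_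
    simpa only [← of_mul, norm_of] using norm_mul_le a b

/-- The involution, extended by continuity. -/
instance instStar : Star (CStarTensor A B) :=
  ⟨Completion.map (star : AlgTensor A B → AlgTensor A B)⟩

theorem of_star (x : AlgTensor A B) : of (star x) = star (of x) :=
  (Completion.map_coe (starNormedAddGroupHom : NormedAddGroupHom (AlgTensor A B)
    (AlgTensor A B)).uniformContinuous x).symm

instance instContinuousStar : ContinuousStar (CStarTensor A B) :=
  ⟨Completion.continuous_map⟩

instance instStarRing : StarRing (CStarTensor A B) where
  star_involutive x := by
    refine induction_on x (isClosed_eq (by fun_prop) (by fun_prop)) fun a => ?_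
    simp only [← of_star, star_star]
  star_mul x y := by
    refine induction_on₂ x y (isClosed_eq (by fun_prop) (by fun_prop)) fun a b => ?_
    simp only [← of_star, ← of_mul, star_mul]
  star_add x y := by
    refine induction_on₂ x y (isClosed_eq (by fun_prop) (by fun_prop)) fun a b => ?_
    simp only [← of_star, ← of_add, star_add]

instance instCStarRing : CStarRing (CStarTensor A B) where
  norm_mul_self_le x := by
    refine induction_on x (isClosed_le (by fun_prop) (by fun_prop)) fun a => ?_
    rw [← of_star, ← of_mul, norm_of, norm_of]
    exact AlgTensor.maxNorm_mul_self_le a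

instance instIsScalarTower : IsScalarTower ℂ (CStarTensor A B) (CStarTensor A B) where
  smul_assoc c x y := by
    refine induction_on₂ x y (isClosed_eq ?_ ?_) fun a b => ?_
    · exact (continuous_fst.const_smul c).mul continuous_snd
    · exact (continuous_fst.mul continuous_snd).const_smul c
    · simp only [smul_eq_mul, ← of_smul, ← of_mul, smul_mul_assoc]

instance instSMulCommClass : SMulCommClass ℂ (CStarTensor A B) (CStarTensor A B) where
  smul_comm c x y := by
    refine induction_on₂ x y (isClosed_eq ?_ ?_) fun a b => ?_
    · exact (continuous_fst.mul continuous_snd).const_smul c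
    · exact continuous_fst.mul (continuous_snd.const_smul c)
    · simp only [smul_eq_mul, ← of_smul, ← of_mul, mul_smul_comm]

instance instStarModule : StarModule ℂ (CStarTensor A B) where
  star_smul c x := by
    refine induction_on x (isClosed_eq ?_ ?_) fun a => ?_
    · exact (continuous_id.const_smul c).star
    · exact continuous_star.const_smul (star c)
    · simp only [← of_star, ← of_smul, star_smul]

instance instNonUnitalCStarAlgebra : NonUnitalCStarAlgebra (CStarTensor A B) where

instance instPartialOrder : PartialOrder (CStarTensor A B) := CStarAlgebra.spectralOrder _

instance instStarOrderedRing : StarOrderedRing (CStarTensor A B) :=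
  CStarAlgebra.spectralOrderedRing _

/-- The elementary tensor `a ⊗ b` in the C⋆-tensor product. -/
def tmul (a : A) (b : B) : CStarTensor A B := of (AlgTensor.tmul a b)

end CStarTensor

end Tensor

/-! ### The Hilbert space tensor product -/

section HilbertTensor

/-- The Hilbert space tensor product of two Hilbert spaces. -/
abbrev HilbertTensor (H : Type*) (K : Type*) [NormedAddCommGroup H] [InnerProductSpace ℂ H]
    [NormedAddCommGroup K] [InnerProductSpace ℂ K] : Type _ :=
  UniformSpace.Completion (H ⊗[ℂ] K)

/-- The bounded operator `S ⊗ T` on the Hilbert space tensor product. -/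
def HilbertTensor.mapL {H K : Type*} [NormedAddCommGroup H] [InnerProductSpace ℂ H]
    [NormedAddCommGroup K] [InnerProductSpace ℂ K] (S : H →L[ℂ] H) (T : K →L[ℂ] K) :
    HilbertTensor H K →L[ℂ] HilbertTensor H K :=
  (TensorProduct.mapL S T).completion

end HilbertTensor

/-! ### Strong Morita equivalence -/

/-- An `A`-`B`-equivalence bimodule structure on a complex Banach space `X`: `X` is a full left
Hilbert `A`-module and a full right Hilbert `B`-module, with commuting actions, such that
`⟨a·x, y⟩_B = ⟨x, a⋆·y⟩_B`, `_A⟨x·b, y⟩ = _A⟨x, y·b⋆⟩` and `_A⟨x, y⟩·z = x·⟨y, z⟩_B`.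
Here `lsmul a x = a·x` and `rsmul b x = x·b`. -/
structure EquivalenceBimodule (A B : Type*) [NonUnitalCStarAlgebra A] [PartialOrder A]
    [NonUnitalCStarAlgebra B] [PartialOrder B]
    (X : Type*) [NormedAddCommGroup X] [NormedSpace ℂ X] [CompleteSpace X] where
  /-- the left action `(a, x) ↦ a·x` -/
  lsmul : A →ₗ[ℂ] X →ₗ[ℂ] X
  /-- the right action `(b, x) ↦ x·b` -/
  rsmul : B →ₗ[ℂ] X →ₗ[ℂ] X
  /-- the left inner product `_A⟨x, y⟩`, linear in `x` and conjugate linear in `y` -/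
  linner : X →ₗ[ℂ] X →ₗ⋆[ℂ] A
  /-- the right inner product `⟨x, y⟩_B`, conjugate linear in `x` and linear in `y` -/
  rinner : X →ₗ⋆[ℂ] X →ₗ[ℂ] B
  mul_lsmul : ∀ a a' x, lsmul (a * a') x = lsmul a (lsmul a' x)
  mul_rsmul : ∀ b b' x, rsmul (b * b') x = rsmul b' (rsmul b x)
  lsmul_rsmul : ∀ a b x, lsmul a (rsmul b x) = rsmul b (lsmul a x)
  linner_lsmul : ∀ a x y, linner (lsmul a x) y = a * linner x y
  rinner_rsmul : ∀ b x y, rinner x (rsmul b y) = rinner x y * b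
  star_linner : ∀ x y, star (linner x y) = linner y x
  star_rinner : ∀ x y, star (rinner x y) = rinner y x
  linner_self_nonneg : ∀ x, 0 ≤ linner x x
  rinner_self_nonneg : ∀ x, 0 ≤ rinner x x
  norm_linner_self : ∀ x, ‖linner x x‖ = ‖x‖ ^ 2
  norm_rinner_self : ∀ x, ‖rinner x x‖ = ‖x‖ ^ 2
  linner_full : (Submodule.span ℂ {a : A | ∃ x y, linner x y = a}).topologicalClosure = ⊤
  rinner_full : (Submodule.span ℂ {b : B | ∃ x y, rinner x y = b}).topologicalClosure = ⊤
  rinner_lsmul : ∀ a x y, rinner (lsmul a x) y = rinner x (lsmul (star a) y)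
  linner_rsmul : ∀ b x y, linner (rsmul b x) y = linner x (rsmul (star b) y)
  linner_lsmul_eq : ∀ x y z, lsmul (linner x y) z = rsmul (rinner y z) x

/-- A representation `π` of `A` on `H` is non-degenerate if `π(A)H` spans a dense subspace. -/
def IsNondegenerate {A H : Type*} [NonUnitalCStarAlgebra A] [NormedAddCommGroup H]
    [InnerProductSpace ℂ H] [CompleteSpace H] (π : A →⋆ₙₐ[ℂ] (H →L[ℂ] H)) : Prop :=
  (Submodule.span ℂ {η : H | ∃ a ξ, π a ξ = η}).topologicalClosure = ⊤

/-- `(πA, πX, πB)` is a representation of the equivalence bimodule on the pair `(H, K)`. -/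
structure IsBimoduleRepresentation {A B X H K : Type*}
    [NonUnitalCStarAlgebra A] [PartialOrder A] [NonUnitalCStarAlgebra B] [PartialOrder B]
    [NormedAddCommGroup X] [NormedSpace ℂ X] [CompleteSpace X]
    [NormedAddCommGroup H] [InnerProductSpace ℂ H] [CompleteSpace H]
    [NormedAddCommGroup K] [InnerProductSpace ℂ K] [CompleteSpace K]
    (E : EquivalenceBimodule A B X)
    (πA : A →⋆ₙₐ[ℂ] (H →L[ℂ] H)) (πX : X →ₗ[ℂ] (K →L[ℂ] H)) (πB : B →⋆ₙₐ[ℂ] (K →L[ℂ] K)) :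
    Prop where
  nondegenerate_left : IsNondegenerate πA
  nondegenerate_right : IsNondegenerate πB
  comp_adjoint : ∀ x y, πX x ∘L (πX y).adjoint = πA (E.linner x y)
  adjoint_comp : ∀ x y, (πX x).adjoint ∘L πX y = πB (E.rinner x y)
  map_smul_smul : ∀ a x b, πX (E.rsmul b (E.lsmul a x)) = πA a ∘L πX x ∘L πB b

/-- Strong Morita equivalence of two (non-degenerate) representations. -/
def RepStronglyMoritaEquivalent {A : Type u} {B : Type u'} {H : Type v} {K : Type v'}
    [NonUnitalCStarAlgebra A] [PartialOrder A] [NonUnitalCStarAlgebra B] [PartialOrder B]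
    [NormedAddCommGroup H] [InnerProductSpace ℂ H] [CompleteSpace H]
    [NormedAddCommGroup K] [InnerProductSpace ℂ K] [CompleteSpace K]
    (πA : A →⋆ₙₐ[ℂ] (H →L[ℂ] H)) (πB : B →⋆ₙₐ[ℂ] (K →L[ℂ] K)) : Prop :=
  ∃ (X : Type (max u u')) (_ : NormedAddCommGroup X) (_ : NormedSpace ℂ X) (_ : CompleteSpace X)
    (E : EquivalenceBimodule A B X) (πX : X →ₗ[ℂ] (K →L[ℂ] H)),
    IsBimoduleRepresentation E πA πX πB

/-- `(π, V, L)` is a minimal Stinespring representation for the completely positive map `φ`: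
`φ(a) = V⋆ π(a) V`, `‖V‖² = ‖φ‖`, and the closed linear span of `π(A)VH` is `L`. -/
structure IsMinimalStinespring {A H L : Type*}
    [NonUnitalCStarAlgebra A] [PartialOrder A] [StarOrderedRing A]
    [NormedAddCommGroup H] [InnerProductSpace ℂ H] [CompleteSpace H]
    [NormedAddCommGroup L] [InnerProductSpace ℂ L] [CompleteSpace L]
    (φ : A →CP (H →L[ℂ] H)) (π : A →⋆ₙₐ[ℂ] (L →L[ℂ] L)) (V : H →L[ℂ] L) : Prop where
  dilation : ∀ a, φ a = V.adjoint ∘L π a ∘L V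
  norm_sq : IsLUB {r : ℝ | ∃ a : A, ‖a‖ ≤ 1 ∧ ‖φ a‖ = r} (‖V‖ ^ 2)
  minimal : (Submodule.span ℂ {η : L | ∃ a ξ, π a (V ξ) = η}).topologicalClosure = ⊤

/-- Strong Morita equivalence of completely positive maps: a minimal Stinespring representation
for the first is strongly Morita equivalent to one for the second. -/
def CPStronglyMoritaEquivalent {A : Type u} {B : Type u'} {H : Type v} {K : Type v'}
    [NonUnitalCStarAlgebra A] [PartialOrder A] [StarOrderedRing A]
    [NonUnitalCStarAlgebra B] [PartialOrder B] [StarOrderedRing B]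
    [NormedAddCommGroup H] [InnerProductSpace ℂ H] [CompleteSpace H]
    [NormedAddCommGroup K] [InnerProductSpace ℂ K] [CompleteSpace K]
    (φ : A →CP (H →L[ℂ] H)) (ψ : B →CP (K →L[ℂ] K)) : Prop :=
  ∃ (Lφ : Type (max u v)) (_ : NormedAddCommGroup Lφ) (_ : InnerProductSpace ℂ Lφ)
    (_ : CompleteSpace Lφ) (πφ : A →⋆ₙₐ[ℂ] (Lφ →L[ℂ] Lφ)) (Vφ : H →L[ℂ] Lφ)
    (Lψ : Type (max u' v')) (_ : NormedAddCommGroup Lψ) (_ : InnerProductSpace ℂ Lψ)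
    (_ : CompleteSpace Lψ) (πψ : B →⋆ₙₐ[ℂ] (Lψ →L[ℂ] Lψ)) (Vψ : K →L[ℂ] Lψ),
    IsMinimalStinespring φ πφ Vφ ∧ IsMinimalStinespring ψ πψ Vψ ∧
      RepStronglyMoritaEquivalent πφ πψ

/-- `Φ = φ ⊗ id_𝐊 : A ⊗ 𝐊(H₀) → 𝐁(H ⊗ H₀)`, i.e. `Φ(a ⊗ k) = φ(a) ⊗ k`. -/
def IsStabilization {A H H₀ : Type*}
    [NonUnitalCStarAlgebra A] [PartialOrder A] [StarOrderedRing A]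
    [NormedAddCommGroup H] [InnerProductSpace ℂ H] [CompleteSpace H]
    [NormedAddCommGroup H₀] [InnerProductSpace ℂ H₀] [CompleteSpace H₀]
    (φ : A →CP (H →L[ℂ] H))
    (Φ : CStarTensor A (compactOperators H₀) →CP (HilbertTensor H H₀ →L[ℂ] HilbertTensor H H₀)) :
    Prop :=
  ∀ (a : A) (k : compactOperators H₀),
    Φ (CStarTensor.tmul a k) = HilbertTensor.mapL (φ a) (k : H₀ →L[ℂ] H₀)

end

/-! ### The Stinespring dilation of a completely positive map -/

noncomputable section

/-! Let `(π, V)` be the Stinespring representation of `φ` on the completion of `A ⊗ H` for the form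
`⟨a ⊗ ξ, b ⊗ η⟩ = ⟨ξ, φ(a⋆b)η⟩`. Then `φ ⊗ id` is the compression of `π ⊗ id` by `V ⊗ 1`, hence
completely positive. It is the only such map, because completely positive maps are continuous and
elementary tensors span a dense subspace. The pair `(π ⊗ id, V ⊗ 1)` is again a minimal Stinespring
representation (`isMinimalStinespring_stabilization`), so it remains to compare `π` with `π ⊗ id`.

Fix a unit vector `e` and let `p` be the projection onto its span. The bimodule is the row `X = p(A
⊗ 𝐊)`, the closed span of all `a ⊗ |e⟩⟨y|`, with `⟨x, y⟩ = x⋆y` on the right. On the left `xy⋆` lies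
in the corner `A ⊗ p`, which is identified with `A` by the isometry `a ↦ a ⊗ p`. With `Jξ = ξ ⊗ e`,
the map `x ↦ J⋆(π ⊗ id)(x)` represents `X` (`isBimoduleRepresentation_cornerRep`): `J⋆J = 1` gives
the left inner product, and `JJ⋆ = 1 ⊗ p`, which fixes the range of every `(π ⊗ id)(x)`, gives the
right one.

Two points need care. Since `A` may lack a unit, `V` cannot be defined by `ξ ↦ 1 ⊗ ξ`; it is the
adjoint of `a ⊗ ξ ↦ φ(a)ξ`, whose sharp bound comes from an approximate unit
(`preCompress_norm_le`). Since the norm of `A ⊗ 𝐊` is a supremum of seminorms, the injectivity of `a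
↦ a ⊗ p` has to be shown by exhibiting enough representations, which come from Hahn-Banach
separation and the GNS construction (`cornerHom_injective`). -/

theorem norm_adjoint_comp_comp_le {L : Type*} [NormedAddCommGroup L] [InnerProductSpace ℂ L]
    [CompleteSpace L] {H : Type*} [NormedAddCommGroup H]
    [InnerProductSpace ℂ H] [CompleteSpace H] (V : H →L[ℂ] L) (T : L →L[ℂ] L) (hT : ‖T‖ ≤ 1) :
    ‖V.adjoint ∘L T ∘L V‖ ≤ ‖V‖ ^ 2 :=
  calc ‖V.adjoint ∘L T ∘L V‖ ≤ ‖V.adjoint‖ * (‖T‖ * ‖V‖) :=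
        (ContinuousLinearMap.opNorm_comp_le _ _).trans
          (by gcongr; exact ContinuousLinearMap.opNorm_comp_le _ _)
    _ ≤ ‖V‖ * (1 * ‖V‖) := by rw [LinearIsometryEquiv.norm_map]; gcongr
    _ = ‖V‖ ^ 2 := by ring

theorem NonUnitalCStarAlgebra.nonneg_iff_exists_star_mul_self {A : Type*} [NonUnitalCStarAlgebra A]
    [PartialOrder A] [StarOrderedRing A] {a : A} : 0 ≤ a ↔ ∃ b, a = star b * b :=
  CStarAlgebra.nonneg_iff_eq_star_mul_self

theorem CStarMatrix.nonneg_iff_exists_star_mul_self {A : Type*} [NonUnitalCStarAlgebra A]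
    [PartialOrder A] [StarOrderedRing A] {n : Type*} [Fintype n] {M : CStarMatrix n n A} :
    0 ≤ M ↔ ∃ N, M = star N * N :=
  NonUnitalCStarAlgebra.nonneg_iff_exists_star_mul_self

namespace CompletelyPositiveMap

variable {A : Type*} [NonUnitalCStarAlgebra A] [PartialOrder A] [StarOrderedRing A]
  {H : Type*} [NormedAddCommGroup H] [InnerProductSpace ℂ H] [CompleteSpace H]

open scoped ComplexOrder

/-- The matrix `(a i⋆ a j)` is `N⋆N`, where `N` carries the `a j` in the single row `i₀` and is zero
elsewhere. Complete positivity writes its image as `R⋆R`, and the double sum becomes `∑ k, ‖∑ i, R k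
i (ξ i)‖²`. -/
theorem sum_inner_nonneg (φ : A →CP (H →L[ℂ] H)) {ι : Type*} [Fintype ι] (a : ι → A) (ξ : ι → H) :
    0 ≤ ∑ i, ∑ j, ⟪ξ i, φ (star (a i) * a j) (ξ j)⟫_ℂ := by
  classical
  rcases isEmpty_or_nonempty ι with h | ⟨⟨i₀⟩⟩
  · simp
  let N : CStarMatrix ι ι A := CStarMatrix.ofMatrix fun k j => if k = i₀ then a j else 0
  have hN (i j : ι) : (star N * N) i j = star (a i) * a j := by
    have hNa (k j : ι) : N k j = if k = i₀ then a j else 0 := rfl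
    simp [CStarMatrix.mul_apply, CStarMatrix.star_apply, hNa]
  obtain ⟨R, hφ⟩ : ∃ R : ι → ι → H →L[ℂ] H,
      ∀ i j, φ (star (a i) * a j) = ∑ k, (R k i).adjoint ∘L R k j := by
    obtain ⟨R, hR⟩ := CStarMatrix.nonneg_iff_exists_star_mul_self.1
      (φ.map_cstarMatrix_nonneg (star N * N) (star_mul_self_nonneg N))
    refine ⟨R, fun i j => ?_⟩
    rw [← hN]
    exact congrFun (congrFun hR i) j
  have key : ∑ i, ∑ j, ⟪ξ i, φ (star (a i) * a j) (ξ j)⟫_ℂ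
      = ∑ k, ⟪∑ i, R k i (ξ i), ∑ j, R k j (ξ j)⟫_ℂ := by
    have h : ∀ i j :ι, ⟪ξ i, φ (star (a i) * a j) (ξ j)⟫_ℂ
        = ∑ k, ⟪R k i (ξ i), R k j (ξ j)⟫_ℂ := by
      intro i j
      rw [hφ, sum_apply, inner_sum]
      refine Finset.sum_congr rfl fun k _ => ?_
      rw [ContinuousLinearMap.comp_apply, ContinuousLinearMap.adjoint_inner_right]
    simp only [h, inner_sum, sum_inner]
    rw [Finset.sum_comm_cycle]
    refine Finset.sum_congr rfl fun k _ => ?_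
    rw [Finset.sum_comm]
  rw [key]
  exact Finset.sum_nonneg fun k _ => by
    rw [inner_self_eq_norm_sq_to_K]
    exact pow_nonneg (RCLike.ofReal_nonneg.2 (norm_nonneg (∑ i, R k i (ξ i)))) 2

/-- The sesquilinear form `⟨a ⊗ ξ, b ⊗ η⟩ = ⟨ξ, φ(a⋆b)η⟩` on `A ⊗ H`. -/
def dilationForm (φ : A →CP (H →L[ℂ] H)) : A ⊗[ℂ] H →ₗ⋆[ℂ] A ⊗[ℂ] H →ₗ[ℂ] ℂ :=
  TensorProduct.lift <| LinearMap.mk₂'ₛₗ (starRingEnd ℂ) (starRingEnd ℂ)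
    (fun a ξ => innerₛₗ ℂ ξ ∘ₗ TensorProduct.lift
      (ContinuousLinearMap.coeLM ℂ ∘ₗ φ.toLinearMap ∘ₗ LinearMap.mulLeft ℂ (star a)))
    (fun a a' ξ => TensorProduct.ext' fun b η => by simp [add_mul, inner_add_right])
    (fun c a ξ => TensorProduct.ext' fun b η => by
      have h : φ.toLinearMap (star (c • a) * b) = starRingEnd ℂ c • φ.toLinearMap (star a * b) := by
        rw [star_smul, smul_mul_assoc, map_smul]; rfl
      simp only [LinearMap.comp_apply, TensorProduct.lift.tmul, LinearMap.mulLeft_apply, h,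
        LinearMap.smul_apply]
      simp)
    (fun a ξ ξ' => TensorProduct.ext' fun b η => by simp)
    (fun c a ξ => TensorProduct.ext' fun b η => by simp)

theorem dilationForm_tmul (φ : A →CP (H →L[ℂ] H)) (a b : A) (ξ η : H) :
    φ.dilationForm (a ⊗ₜ ξ) (b ⊗ₜ η) = ⟪ξ, φ (star a * b) η⟫_ℂ := rfl

theorem map_star' (φ : A →CP (H →L[ℂ] H)) (a : A) : φ (star a) = (φ a).adjoint :=
  map_star φ a

theorem dilationForm_conj (φ : A →CP (H →L[ℂ] H)) (x y : A ⊗[ℂ] H) :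
    starRingEnd ℂ (φ.dilationForm y x) = φ.dilationForm x y := by
  induction x using TensorProduct.induction_on with
  | zero => simp
  | add x x' hx hx' => simp [hx, hx']
  | tmul a ξ =>
    induction y using TensorProduct.induction_on with
    | zero => simp
    | add y y' hy hy' => simp [hy, hy']
    | tmul b η =>
      rw [dilationForm_tmul, dilationForm_tmul, inner_conj_symm,
        ← ContinuousLinearMap.adjoint_inner_right, ← map_star', star_mul, star_star]

theorem dilationForm_self_nonneg (φ : A →CP (H →L[ℂ] H)) (x : A ⊗[ℂ] H) :
    0 ≤ φ.dilationForm x x := by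
  obtain ⟨n, a, ξ, rfl⟩ := TensorProduct.exists_sum_tmul_eq x
  have h := φ.sum_inner_nonneg a ξ
  rw [Finset.sum_comm] at h
  simpa [dilationForm_tmul] using h

/-- The algebraic tensor product `A ⊗ H`, which receives the inner product defined by `φ`. -/
@[nolint unusedArguments]
def PreDilation (_ : A →CP (H →L[ℂ] H)) : Type _ := A ⊗[ℂ] H

instance (φ : A →CP (H →L[ℂ] H)) : AddCommGroup φ.PreDilation :=
  inferInstanceAs (AddCommGroup (A ⊗[ℂ] H))

instance (φ : A →CP (H →L[ℂ] H)) : Module ℂ φ.PreDilation :=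
  inferInstanceAs (Module ℂ (A ⊗[ℂ] H))

/-- The semi-inner product on `A ⊗ H`. -/
abbrev preDilationCore (φ : A →CP (H →L[ℂ] H)) : PreInnerProductSpace.Core ℂ φ.PreDilation where
  inner x y := φ.dilationForm x y
  conj_inner_symm x y := φ.dilationForm_conj x y
  re_inner_nonneg x := (Complex.nonneg_iff.1 (φ.dilationForm_self_nonneg x)).1
  add_left x y z := LinearMap.map_add₂ φ.dilationForm x y z
  smul_left x y c := LinearMap.map_smulₛₗ₂ φ.dilationForm c x y

instance (φ : A →CP (H →L[ℂ] H)) : SeminormedAddCommGroup φ.PreDilation :=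
  InnerProductSpace.Core.toSeminormedAddCommGroup (c := φ.preDilationCore)

instance (φ : A →CP (H →L[ℂ] H)) : InnerProductSpace ℂ φ.PreDilation :=
  InnerProductSpace.ofCore φ.preDilationCore

/-- The Stinespring dilation space of `φ`. -/
def Dilation (φ : A →CP (H →L[ℂ] H)) : Type _ := UniformSpace.Completion φ.PreDilation

instance (φ : A →CP (H →L[ℂ] H)) : NormedAddCommGroup φ.Dilation :=
  inferInstanceAs (NormedAddCommGroup (UniformSpace.Completion φ.PreDilation))

instance (φ : A →CP (H →L[ℂ] H)) : InnerProductSpace ℂ φ.Dilation :=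
  inferInstanceAs (InnerProductSpace ℂ (UniformSpace.Completion φ.PreDilation))

instance (φ : A →CP (H →L[ℂ] H)) : CompleteSpace φ.Dilation :=
  inferInstanceAs (CompleteSpace (UniformSpace.Completion φ.PreDilation))

variable (φ : A →CP (H →L[ℂ] H))

/-- The elementary tensor `a ⊗ ξ` in the dilation space. -/
def preTmul (a : A) (ξ : H) : φ.PreDilation := a ⊗ₜ[ℂ] ξ

theorem preDilation_inner_tmul (a b : A) (ξ η : H) :
    ⟪φ.preTmul a ξ, φ.preTmul b η⟫_ℂ = ⟪ξ, φ (star a * b) η⟫_ℂ := rfl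

theorem preDilation_induction {p : φ.PreDilation → Prop} (z : φ.PreDilation) (zero : p 0)
    (tmul : ∀ a ξ, p (φ.preTmul a ξ)) (add : ∀ x y, p x → p y → p (x + y)) : p z :=
  TensorProduct.induction_on (motive := p) z zero tmul add

/-- An endomorphism of `A` acting on the left factor of `A ⊗ H`. -/
def preAct (f : A →ₗ[ℂ] A) : φ.PreDilation →ₗ[ℂ] φ.PreDilation := LinearMap.rTensor H f

@[simp] theorem preAct_tmul (f : A →ₗ[ℂ] A) (a : A) (ξ : H) :
    φ.preAct f (φ.preTmul a ξ) = φ.preTmul (f a) ξ := rfl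

omit [PartialOrder A] [StarOrderedRing A] in
-- In the unitization `‖a‖² - a⋆a` is positive, so it equals `c⋆c`, and left multiplication by `c`
-- preserves the ideal `A`. This is the square root behind the boundedness of left multiplication on
-- the dilation space.
theorem exists_linearMap_star_mul_eq (a : A) : ∃ D : A →ₗ[ℂ] A, ∀ b c : A,
    star (D b) * D c = (‖a‖ ^ 2 : ℂ) • (star b * c) - star (a * b) * (a * c) := by
  let _ : PartialOrder A := CStarAlgebra.spectralOrder A
  have _ : StarOrderedRing A := CStarAlgebra.spectralOrderedRing A
  let _ : PartialOrder (Unitization ℂ A) := CStarAlgebra.spectralOrder _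
  have _ : StarOrderedRing (Unitization ℂ A) := CStarAlgebra.spectralOrderedRing _
  have h : 0 ≤ algebraMap ℝ (Unitization ℂ A) (‖a‖ ^ 2) - star (a : Unitization ℂ A) * a := by
    rw [sub_nonneg]
    have := CStarAlgebra.star_mul_le_algebraMap_norm_sq (a := (a : Unitization ℂ A))
    rwa [Unitization.norm_inr] at this
  obtain ⟨c, hc⟩ := CStarAlgebra.nonneg_iff_eq_star_mul_self.1 h
  refine ⟨c.fst • LinearMap.id + LinearMap.mulLeft ℂ c.snd, fun b d => ?_⟩
  have hD (b : A) : (((c.fst • LinearMap.id + LinearMap.mulLeft ℂ c.snd : A →ₗ[ℂ] A) b : A) :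
      Unitization ℂ A) = c * b := by
    ext <;> simp [Unitization.fst_mul, Unitization.snd_mul]
  apply Unitization.inr_injective (R := ℂ)
  rw [Unitization.inr_mul, Unitization.inr_star, hD, hD, star_mul, mul_assoc, ← mul_assoc (star c),
    ← hc]
  simp only [Unitization.inr_sub, Unitization.inr_smul, Unitization.inr_mul, Unitization.inr_star,
    star_mul, sub_mul, mul_sub, mul_assoc]
  congr 1
  rw [Algebra.algebraMap_eq_smul_one, smul_mul_assoc, one_mul, mul_smul_comm]
  norm_cast

/-- The map `D` of the preceding lemma satisfies `‖Dx‖² = ‖a‖²‖x‖² - ‖ax‖²`, first as a sesquilinear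
identity on elementary tensors; the left side is nonnegative. -/
theorem preAct_norm_le (a : A) (x : φ.PreDilation) :
    ‖φ.preAct (LinearMap.mulLeft ℂ a) x‖ ≤ ‖a‖ * ‖x‖ := by
  obtain ⟨D, hD⟩ := exists_linearMap_star_mul_eq a
  have key (x y : φ.PreDilation) : ⟪φ.preAct D x, φ.preAct D y⟫_ℂ = (‖a‖ ^ 2 : ℂ) * ⟪x, y⟫_ℂ
      - ⟪φ.preAct (LinearMap.mulLeft ℂ a) x, φ.preAct (LinearMap.mulLeft ℂ a) y⟫_ℂ := by
    induction x using preDilation_induction with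
    | zero => simp
    | add x x' hx hx' => simp only [map_add, inner_add_left, hx, hx']; ring
    | tmul b ξ =>
      induction y using preDilation_induction with
      | zero => simp
      | add y y' hy hy' => simp only [map_add, inner_add_right, hy, hy']; ring
      | tmul c η =>
        simp only [preAct_tmul, preDilation_inner_tmul, LinearMap.mulLeft_apply, hD, map_sub,
          map_smul, sub_apply, smul_apply, inner_sub_right,
          inner_smul_right]
  have h := key x x
  simp only [inner_self_eq_norm_sq_to_K] at h
  have h' : ‖φ.preAct D x‖ ^ 2 = ‖a‖ ^ 2 * ‖x‖ ^ 2
      - ‖φ.preAct (LinearMap.mulLeft ℂ a) x‖ ^ 2 := by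
    rw [← Complex.ofReal_inj]; push_cast; exact h
  refine (sq_le_sq₀ (norm_nonneg _) (by positivity)).1 ?_
  nlinarith [sq_nonneg ‖φ.preAct D x‖]

/-- Left multiplication by `a` on the dilation space. -/
def leftMulL (a : A) : φ.PreDilation →L[ℂ] φ.PreDilation :=
  (φ.preAct (LinearMap.mulLeft ℂ a)).mkContinuous ‖a‖ (φ.preAct_norm_le a)

/-- The elementary tensor `a ⊗ ξ` as an element of the dilation space. -/
def dilTmul (a : A) (ξ : H) : φ.Dilation :=
  (φ.preTmul a ξ : UniformSpace.Completion φ.PreDilation)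

theorem inner_dilTmul (a b : A) (ξ η : H) :
    ⟪φ.dilTmul a ξ, φ.dilTmul b η⟫_ℂ = ⟪ξ, φ (star a * b) η⟫_ℂ := by
  exact UniformSpace.Completion.inner_coe _ _

theorem span_dilTmul :
    (Submodule.span ℂ {η : φ.Dilation | ∃ a ξ, φ.dilTmul a ξ = η}).topologicalClosure = ⊤ := by
  refine (Submodule.eq_top_iff' (p := _)).2 fun x => ?_
  induction (x : UniformSpace.Completion φ.PreDilation) using
    UniformSpace.Completion.induction_on with
  | hp => exact isClosed_closure (X := φ.Dilation)
  | ih x =>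
    refine Submodule.le_topologicalClosure _ ?_
    induction x using preDilation_induction with
    | zero => exact Submodule.zero_mem _
    | add x y hx hy =>
      rw [UniformSpace.Completion.coe_add]
      exact Submodule.add_mem (M := φ.Dilation) _ hx hy
    | tmul a ξ => exact Submodule.subset_span ⟨a, ξ, rfl⟩

variable {φ} in
theorem dilation_ext {E : Type*} [NormedAddCommGroup E] [NormedSpace ℂ E]
    {S T : φ.Dilation →L[ℂ] E} (h : ∀ a ξ, S (φ.dilTmul a ξ) = T (φ.dilTmul a ξ)) : S = T := by
  refine ContinuousLinearMap.ext_on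
    (s := {η : φ.Dilation | ∃ a ξ, φ.dilTmul a ξ = η}) ?_ ?_
  · exact Submodule.dense_iff_topologicalClosure_eq_top.2 φ.span_dilTmul
  · rintro _ ⟨a, ξ, rfl⟩; exact h a ξ

variable {φ} in
theorem dilation_ext_inner {x y : φ.Dilation}
    (h : ∀ a ξ, ⟪φ.dilTmul a ξ, x⟫_ℂ = ⟪φ.dilTmul a ξ, y⟫_ℂ) : x = y := by
  have : innerSL ℂ x = innerSL ℂ y := by
    refine dilation_ext fun a ξ => ?_
    rw [innerSL_apply_apply, innerSL_apply_apply, ← inner_conj_symm, h, inner_conj_symm]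
  exact ext_inner_right ℂ fun v => by simpa using congr($this v)

/-- The action of `a` on the dilation space. -/
def dilRepL (a : A) : φ.Dilation →L[ℂ] φ.Dilation := (φ.leftMulL a).completion

@[simp] theorem dilRepL_tmul (a b : A) (ξ : H) :
    φ.dilRepL a (φ.dilTmul b ξ) = φ.dilTmul (a * b) ξ := by
  exact ContinuousLinearMap.completion_apply_coe _ _

theorem dilTmul_add (a b : A) (ξ : H) : φ.dilTmul (a + b) ξ = φ.dilTmul a ξ + φ.dilTmul b ξ := by
  have h : φ.preTmul (a + b) ξ = φ.preTmul a ξ + φ.preTmul b ξ := TensorProduct.add_tmul _ _ _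
  rw [dilTmul, h]; exact UniformSpace.Completion.coe_add _ _

theorem dilTmul_smul (c : ℂ) (a : A) (ξ : H) : φ.dilTmul (c • a) ξ = c • φ.dilTmul a ξ := by
  exact UniformSpace.Completion.coe_smul c (φ.preTmul a ξ)

/-- The representation of `A` on the dilation space. -/
def dilRep : A →⋆ₙₐ[ℂ] (φ.Dilation →L[ℂ] φ.Dilation) where
  toFun := φ.dilRepL
  map_smul' c a := dilation_ext fun b ξ => by simp [dilTmul_smul, smul_mul_assoc]
  map_zero' := dilation_ext fun b ξ => by
    rw [dilRepL_tmul, zero_mul, ← zero_smul ℂ b, dilTmul_smul]; simp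
  map_add' a a' := dilation_ext fun b ξ => by simp [dilTmul_add, add_mul]
  map_mul' a a' := dilation_ext fun b ξ => by simp [mul_assoc]
  map_star' a := dilation_ext fun b ξ => dilation_ext_inner fun c η => by
    rw [ContinuousLinearMap.star_eq_adjoint, ContinuousLinearMap.adjoint_inner_right]
    simp [inner_dilTmul, mul_assoc]

@[simp] theorem dilRep_tmul (a b : A) (ξ : H) :
    φ.dilRep a (φ.dilTmul b ξ) = φ.dilTmul (a * b) ξ := φ.dilRepL_tmul a b ξ

/-- The map `a ⊗ ξ ↦ φ(a)ξ`. -/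
def preCompress : φ.PreDilation →ₗ[ℂ] H :=
  TensorProduct.lift (ContinuousLinearMap.coeLM ℂ ∘ₗ φ.toLinearMap)

@[simp] theorem preCompress_tmul (a : A) (ξ : H) : φ.preCompress (φ.preTmul a ξ) = φ a ξ := rfl

variable {φ} in
-- Let `e` run through an approximate unit and put `ζ = ∑ φ(e aᵢ)ξᵢ` for `x = ∑ aᵢ ⊗ ξᵢ`. Then `⟨e ⊗
-- η, x⟩ = ⟨η, ζ⟩` and `‖e ⊗ ζ‖² = ⟨ζ, φ(e⋆e)ζ⟩ ≤ M‖ζ‖²`. Cauchy-Schwarz with `η = ζ` gives `‖ζ‖ ≤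
-- √M ‖x‖`, and `ζ` tends to the image of `x`.
theorem preCompress_norm_le {M : ℝ} (hM : ∀ a, ‖a‖ ≤ 1 → ‖φ a‖ ≤ M) (x : φ.PreDilation) :
    ‖φ.preCompress x‖ ≤ √M * ‖x‖ := by
  have hl := CStarAlgebra.increasingApproximateUnit A
  have hφc : Continuous φ := map_continuous φ
  have hlim : Filter.Tendsto (fun e => φ.preCompress (φ.preAct (LinearMap.mulLeft ℂ e) x))
      (CStarAlgebra.approximateUnit A) (nhds (φ.preCompress x)) := by
    induction x using preDilation_induction with
    | zero => simp
    | add x y hx hy => simpa using hx.add hy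
    | tmul a ξ =>
      simp only [preAct_tmul, preCompress_tmul, LinearMap.mulLeft_apply]
      have h1 := (hφc.tendsto a).comp (hl.tendsto_mul_right a)
      exact ((ContinuousLinearMap.apply ℂ H ξ).continuous.tendsto _).comp h1
  refine le_of_tendsto hlim.norm ?_
  filter_upwards [hl.eventually_norm, hl.eventually_star_eq] with e he hes
  have h1 (η : H) : ⟪φ.preTmul e η, x⟫_ℂ
      = ⟪η, φ.preCompress (φ.preAct (LinearMap.mulLeft ℂ e) x)⟫_ℂ := by
    clear hlim
    induction x using preDilation_induction with
    | zero => simp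
    | add x y hx hy => simp [inner_add_right, hx, hy]
    | tmul a ξ => simp [preDilation_inner_tmul, hes]
  set ζ := φ.preCompress (φ.preAct (LinearMap.mulLeft ℂ e) x)
  have hM0 : 0 ≤ M := (norm_nonneg _).trans (hM 0 (by simp))
  have h2 : ‖φ.preTmul e ζ‖ ≤ √M * ‖ζ‖ := by
    refine (sq_le_sq₀ (norm_nonneg _) (by positivity)).1 ?_
    rw [← inner_self_eq_norm_sq (𝕜 := ℂ), preDilation_inner_tmul, mul_pow, Real.sq_sqrt hM0]
    refine (RCLike.re_le_norm _).trans ((norm_inner_le_norm _ _).trans ?_)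
    have h3 : ‖φ (star e * e)‖ ≤ M := by
      refine hM _ ?_
      rw [CStarRing.norm_star_mul_self]; nlinarith [norm_nonneg e]
    calc ‖ζ‖ * ‖φ (star e * e) ζ‖ ≤ ‖ζ‖ * (M * ‖ζ‖) := by
          gcongr; exact (ContinuousLinearMap.le_opNorm _ _).trans (by gcongr)
      _ = _ := by ring
  have h4 : ‖ζ‖ * ‖ζ‖ ≤ √M * ‖x‖ * ‖ζ‖ := by
    calc ‖ζ‖ * ‖ζ‖ = ‖⟪ζ, ζ⟫_ℂ‖ := by rw [inner_self_eq_norm_sq_to_K]; simp [sq]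
      _ = ‖⟪φ.preTmul e ζ, x⟫_ℂ‖ := by rw [h1]
      _ ≤ ‖φ.preTmul e ζ‖ * ‖x‖ := norm_inner_le_norm _ _
      _ ≤ √M * ‖ζ‖ * ‖x‖ := by gcongr
      _ = _ := by ring
  rcases (norm_nonneg ζ).eq_or_lt with h | h
  · rw [← h]; positivity
  · exact le_of_mul_le_mul_right h4 h

theorem exists_bound : ∃ M : ℝ, ∀ a, ‖a‖ ≤ 1 → ‖φ a‖ ≤ M := by
  let f : A →L[ℂ] (H →L[ℂ] H) := ⟨φ.toLinearMap, map_continuous φ⟩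
  exact ⟨‖f‖, fun a ha => (f.le_opNorm a).trans (mul_le_of_le_one_right (norm_nonneg f) ha)⟩

/-- The bounded extension of `a ⊗ ξ ↦ φ(a)ξ` to the dilation space. -/
def compress : φ.Dilation →L[ℂ] H :=
  (φ.preCompress.mkContinuous _ (preCompress_norm_le φ.exists_bound.choose_spec)).extend
    (UniformSpace.Completion.toComplL (𝕜 := ℂ))

theorem compress_coe (x : φ.PreDilation) :
    φ.compress (x : UniformSpace.Completion φ.PreDilation) = φ.preCompress x :=
  ContinuousLinearMap.extend_eq _ UniformSpace.Completion.denseRange_coe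
    (UniformSpace.Completion.isUniformInducing_coe _) x

@[simp] theorem compress_tmul (a : A) (ξ : H) : φ.compress (φ.dilTmul a ξ) = φ a ξ :=
  φ.compress_coe _

variable {φ} in
-- `compress` is built from an arbitrary bound for `φ` on the unit ball. Here every such bound is
-- admitted, and this yields `‖V‖² ≤ ‖φ‖`.
theorem norm_compress_le {M : ℝ} (hM : ∀ a, ‖a‖ ≤ 1 → ‖φ a‖ ≤ M) : ‖φ.compress‖ ≤ √M := by
  refine ContinuousLinearMap.opNorm_le_bound _ (Real.sqrt_nonneg M) fun x => ?_
  induction (x : UniformSpace.Completion φ.PreDilation) using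
    UniformSpace.Completion.induction_on with
  | hp => exact isClosed_le (φ.compress.continuous.norm) (continuous_norm.const_mul (√M))
  | ih x =>
    have h : ‖(show φ.Dilation from (x : UniformSpace.Completion φ.PreDilation))‖ = ‖x‖ :=
      UniformSpace.Completion.norm_coe x
    rw [compress_coe]
    exact (preCompress_norm_le hM x).trans_eq (congrArg _ h.symm)

/-- The Stinespring operator. -/
def dilOp : H →L[ℂ] φ.Dilation := φ.compress.adjoint

/-- This replaces the formula `Vξ = 1 ⊗ ξ` of the unital case. Minimality and the dilation identity
both follow from it. -/
theorem dilRep_dilOp (a : A) (ξ : H) : φ.dilRep a (φ.dilOp ξ) = φ.dilTmul a ξ := by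
  refine dilation_ext_inner fun b η => ?_
  rw [← ContinuousLinearMap.adjoint_inner_left, ← ContinuousLinearMap.star_eq_adjoint, ← map_star,
    dilRep_tmul, dilOp, ContinuousLinearMap.adjoint_inner_right, compress_tmul, inner_dilTmul,
    ← ContinuousLinearMap.adjoint_inner_right, ← map_star', star_mul, star_star]

theorem dilation_eq (a : A) : φ a = φ.dilOp.adjoint ∘L φ.dilRep a ∘L φ.dilOp := by
  ext ξ
  rw [ContinuousLinearMap.comp_apply, ContinuousLinearMap.comp_apply, dilRep_dilOp, dilOp,
    ContinuousLinearMap.adjoint_adjoint, compress_tmul]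

theorem isMinimalStinespring_dilRep : IsMinimalStinespring φ φ.dilRep φ.dilOp where
  dilation := φ.dilation_eq
  norm_sq := by
    constructor
    · rintro _ ⟨a, ha, rfl⟩
      rw [dilation_eq]
      exact norm_adjoint_comp_comp_le _ _
        ((NonUnitalStarAlgHom.norm_apply_le φ.dilRep a).trans ha)
    · intro M hM
      have hM' : ∀ a, ‖a‖ ≤ 1 → ‖φ a‖ ≤ M := fun a ha => hM ⟨a, ha, rfl⟩
      have hM0 : 0 ≤ M := (norm_nonneg _).trans (hM' 0 (by simp))
      rw [dilOp, LinearIsometryEquiv.norm_map]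
      exact (pow_le_pow_left₀ (norm_nonneg _) (norm_compress_le hM') 2).trans_eq
        (Real.sq_sqrt hM0)
  minimal := by simpa only [dilRep_dilOp] using φ.span_dilTmul

end CompletelyPositiveMap

end

/-! ### Operators between Hilbert space tensor products -/

noncomputable section

/-- A copy of `HilbertTensor H K` whose instances are not unfolded. -/
def HTensor (H : Type*) (K : Type*) [NormedAddCommGroup H] [InnerProductSpace ℂ H]
    [NormedAddCommGroup K] [InnerProductSpace ℂ K] : Type _ := HilbertTensor H K

namespace HTensor

variable {H K H' K' H'' K'' : Type*} [NormedAddCommGroup H] [InnerProductSpace ℂ H]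
  [NormedAddCommGroup K] [InnerProductSpace ℂ K]
  [NormedAddCommGroup H'] [InnerProductSpace ℂ H']
  [NormedAddCommGroup K'] [InnerProductSpace ℂ K']
  [NormedAddCommGroup H''] [InnerProductSpace ℂ H'']
  [NormedAddCommGroup K''] [InnerProductSpace ℂ K'']

instance : NormedAddCommGroup (HTensor H K) :=
  inferInstanceAs (NormedAddCommGroup (UniformSpace.Completion (H ⊗[ℂ] K)))

instance : InnerProductSpace ℂ (HTensor H K) :=
  inferInstanceAs (InnerProductSpace ℂ (UniformSpace.Completion (H ⊗[ℂ] K)))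

instance : CompleteSpace (HTensor H K) :=
  inferInstanceAs (CompleteSpace (UniformSpace.Completion (H ⊗[ℂ] K)))

/-- The inclusion of the algebraic tensor product. -/
def of : H ⊗[ℂ] K →ₗᵢ[ℂ] HTensor H K := UniformSpace.Completion.toComplₗᵢ

theorem induction_of {p : HTensor H K → Prop} (x : HTensor H K) (hp : IsClosed {x | p x})
    (ih : ∀ x, p (of x)) : p x :=
  UniformSpace.Completion.induction_on x hp ih

/-- The elementary tensor `ξ ⊗ η`. -/
def tmul (ξ : H) (η : K) : HTensor H K := of (ξ ⊗ₜ[ℂ] η)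

theorem inner_tmul (ξ ξ' : H) (η η' : K) :
    ⟪tmul ξ η, tmul ξ' η'⟫_ℂ = ⟪ξ, ξ'⟫_ℂ * ⟪η, η'⟫_ℂ := by
  rw [tmul, tmul, LinearIsometry.inner_map_map, TensorProduct.inner_tmul]

theorem norm_tmul (ξ : H) (η : K) : ‖tmul ξ η‖ = ‖ξ‖ * ‖η‖ := by
  rw [tmul, LinearIsometry.norm_map, TensorProduct.norm_tmul]

theorem tmul_add (ξ : H) (η η' : K) : tmul ξ (η + η') = tmul ξ η + tmul ξ η' := by
  simp [tmul, TensorProduct.tmul_add]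

theorem add_tmul (ξ ξ' : H) (η : K) : tmul (ξ + ξ') η = tmul ξ η + tmul ξ' η := by
  simp [tmul, TensorProduct.add_tmul]

theorem tmul_smul (c : ℂ) (ξ : H) (η : K) : tmul ξ (c • η) = c • tmul ξ η := by
  simp [tmul, TensorProduct.tmul_smul]

theorem smul_tmul (c : ℂ) (ξ : H) (η : K) : tmul (c • ξ) η = c • tmul ξ η := by
  simp [tmul, ← TensorProduct.smul_tmul']

theorem mem_of_forall_tmul {M : Submodule ℂ (HTensor H K)}
    (hM : IsClosed (M : Set (HTensor H K))) (h : ∀ ξ η, tmul ξ η ∈ M)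
    (x : HTensor H K) : x ∈ M := by
  refine induction_of x hM fun x => ?_
  induction x using TensorProduct.induction_on with
  | zero => rw [map_zero]; exact M.zero_mem
  | add x y hx hy => rw [map_add]; exact M.add_mem hx hy
  | tmul a ξ => exact h a ξ

theorem clm_ext {E : Type*} [NormedAddCommGroup E] [NormedSpace ℂ E]
    {S T : HTensor H K →L[ℂ] E} (h : ∀ ξ η, S (tmul ξ η) = T (tmul ξ η)) : S = T := by
  ext x
  have := mem_of_forall_tmul (M := (S - T).ker) (ContinuousLinearMap.isClosed_ker _)
    (fun ξ η => by simp [h]) x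
  simpa [sub_eq_zero] using this

theorem ext_inner {x y : HTensor H K}
    (h : ∀ ξ η, ⟪tmul ξ η, x⟫_ℂ = ⟪tmul ξ η, y⟫_ℂ) : x = y := by
  have : innerSL ℂ x = innerSL ℂ y := by
    refine clm_ext fun a ξ => ?_
    rw [innerSL_apply_apply, innerSL_apply_apply, ← inner_conj_symm, h, inner_conj_symm]
  exact ext_inner_right ℂ fun v => by simpa using congr($this v)

/-- The bounded operator `S ⊗ T` between Hilbert space tensor products. -/
def map (S : H →L[ℂ] H') (T : K →L[ℂ] K') : HTensor H K →L[ℂ] HTensor H' K' :=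
  (TensorProduct.mapL S T).completion

theorem map_of (S : H →L[ℂ] H') (T : K →L[ℂ] K') (x : H ⊗[ℂ] K) :
    map S T (of x) = of (TensorProduct.mapL S T x) :=
  ContinuousLinearMap.completion_apply_coe _ x

@[simp] theorem map_tmul (S : H →L[ℂ] H') (T : K →L[ℂ] K') (ξ : H) (η : K) :
    map S T (tmul ξ η) = tmul (S ξ) (T η) := map_of S T _

theorem norm_map_le (S : H →L[ℂ] H') (T : K →L[ℂ] K') : ‖map S T‖ ≤ ‖S‖ * ‖T‖ := by
  refine ContinuousLinearMap.opNorm_le_bound _ (by positivity) fun x => ?_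
  refine induction_of (p := fun x => ‖map S T x‖ ≤ ‖S‖ * ‖T‖ * ‖x‖) x
    (isClosed_le (map S T).continuous.norm (continuous_norm.const_mul _)) fun x => ?_
  rw [map_of, LinearIsometry.norm_map, LinearIsometry.norm_map]
  exact (TensorProduct.mapL S T).le_of_opNorm_le (TensorProduct.norm_mapL_le S T) x

theorem map_comp (S' : H' →L[ℂ] H'') (T' : K' →L[ℂ] K'') (S : H →L[ℂ] H') (T : K →L[ℂ] K') :
    map S' T' ∘L map S T = map (S' ∘L S) (T' ∘L T) := clm_ext fun ξ η => by simp

theorem map_add_left (S S' : H →L[ℂ] H') (T : K →L[ℂ] K') :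
    map (S + S') T = map S T + map S' T := clm_ext fun ξ η => by simp [add_tmul]

theorem map_add_right (S : H →L[ℂ] H') (T T' : K →L[ℂ] K') :
    map S (T + T') = map S T + map S T' := clm_ext fun ξ η => by simp [tmul_add]

theorem map_smul_left (c : ℂ) (S : H →L[ℂ] H') (T : K →L[ℂ] K') :
    map (c • S) T = c • map S T := clm_ext fun ξ η => by simp [smul_tmul]

theorem map_smul_right (c : ℂ) (S : H →L[ℂ] H') (T : K →L[ℂ] K') :
    map S (c • T) = c • map S T := clm_ext fun ξ η => by simp [tmul_smul]

theorem adjoint_map [CompleteSpace H] [CompleteSpace K] [CompleteSpace H'] [CompleteSpace K']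
    (S : H →L[ℂ] H') (T : K →L[ℂ] K') : (map S T).adjoint = map S.adjoint T.adjoint :=
  clm_ext fun ξ η => ext_inner fun ξ' η' => by
    simp [ContinuousLinearMap.adjoint_inner_right, inner_tmul]

/-- The operator `ξ ↦ ξ ⊗ e`. -/
def inclL (H : Type*) [NormedAddCommGroup H] [InnerProductSpace ℂ H] (e : K) :
    H →L[ℂ] HTensor H K :=
  LinearMap.mkContinuous
    { toFun := fun ξ => tmul ξ e
      map_add' := fun ξ ξ' => add_tmul ξ ξ' e
      map_smul' := fun c ξ => smul_tmul c ξ e } ‖e‖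
    (fun ξ => (norm_tmul ξ e).trans_le (mul_comm _ _).le)

@[simp] theorem inclL_apply (e : K) (ξ : H) : inclL H e ξ = tmul ξ e := rfl

theorem adjoint_inclL_tmul [CompleteSpace H] (e : K) (ξ : H) (η : K) :
    (inclL H e).adjoint (tmul ξ η) = ⟪e, η⟫_ℂ • ξ :=
  ext_inner_left ℂ fun ζ => by
    rw [ContinuousLinearMap.adjoint_inner_right, inclL_apply, inner_tmul, inner_smul_right,
      mul_comm]

theorem adjoint_inclL_comp_inclL [CompleteSpace H] {e : K} (he : ‖e‖ = 1) :
    (inclL H e).adjoint ∘L inclL H e = ContinuousLinearMap.id ℂ H := by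
  ext ξ
  simp [adjoint_inclL_tmul, inner_self_eq_norm_sq_to_K, he]

/-- The lower bound comes from testing on the vectors `ξ ⊗ e`. -/
theorem norm_map_rankOne [CompleteSpace H] [CompleteSpace H'] {e : K} (he : ‖e‖ = 1)
    (S : H →L[ℂ] H') : ‖map S (InnerProductSpace.rankOne ℂ e e)‖ = ‖S‖ := by
  refine le_antisymm ((norm_map_le _ _).trans (by simp [he])) ?_
  refine S.opNorm_le_bound (norm_nonneg (map S (InnerProductSpace.rankOne ℂ e e))) fun ξ => ?_
  have := (map S (InnerProductSpace.rankOne ℂ e e)).le_opNorm (tmul ξ e)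
  simpa [norm_tmul, he, inner_self_eq_norm_sq_to_K] using this

end HTensor

/-! ### Homomorphisms from the C⋆-tensor product -/

namespace CStarTensor

variable {A B : Type*} [NonUnitalCStarAlgebra A] [NonUnitalCStarAlgebra B]

theorem tmul_add (a : A) (b b' : B) : tmul a (b + b') = tmul a b + tmul a b' := by
  rw [tmul, tmul, tmul, ← of_add]; exact congrArg of (TensorProduct.tmul_add a b b')

theorem add_tmul (a a' : A) (b : B) : tmul (a + a') b = tmul a b + tmul a' b := by
  rw [tmul, tmul, tmul, ← of_add]; exact congrArg of (TensorProduct.add_tmul a a' b)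

theorem tmul_smul (c : ℂ) (a : A) (b : B) : tmul a (c • b) = c • tmul a b := by
  rw [tmul, tmul, ← of_smul]; exact congrArg of (TensorProduct.tmul_smul c a b)

theorem smul_tmul (c : ℂ) (a : A) (b : B) : tmul (c • a) b = c • tmul a b := by
  rw [tmul, tmul, ← of_smul]; exact congrArg of (TensorProduct.smul_tmul' c a b).symm

theorem tmul_mul_tmul (a a' : A) (b b' : B) :
    tmul a b * tmul a' b' = tmul (a * a') (b * b') := by
  rw [tmul, tmul, ← of_mul, AlgTensor.tmul_mul_tmul, tmul]

theorem star_tmul (a : A) (b : B) : star (tmul a b) = tmul (star a) (star b) := by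
  rw [tmul, ← of_star, AlgTensor.star_tmul, tmul]

theorem norm_tmul_le (a : A) (b : B) : ‖tmul a b‖ ≤ ‖a‖ * ‖b‖ := by
  rw [tmul, norm_of, AlgTensor.norm_def]
  exact ciSup_le fun p => p.2.tmul_le a b

theorem mem_of_forall_tmul {M : Submodule ℂ (CStarTensor A B)}
    (hM : IsClosed (M : Set (CStarTensor A B))) (h : ∀ a b, tmul a b ∈ M)
    (x : CStarTensor A B) : x ∈ M := by
  refine induction_on x hM fun x => ?_
  induction x using AlgTensor.induction_on with
  | zero => rw [of_zero]; exact M.zero_mem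
  | add x y hx hy => rw [of_add]; exact M.add_mem hx hy
  | tmul a b => exact h a b

theorem clm_ext {E : Type*} [NormedAddCommGroup E] [NormedSpace ℂ E]
    {S T : CStarTensor A B →L[ℂ] E} (h : ∀ a b, S (tmul a b) = T (tmul a b)) : S = T := by
  ext x
  have := mem_of_forall_tmul (M := (S - T).ker) (ContinuousLinearMap.isClosed_ker _)
    (fun ξ η => by simp [h]) x
  simpa [sub_eq_zero] using this

variable {C : Type*} [NonUnitalCStarAlgebra C]

/-- The C⋆-seminorm defined by a ⋆-homomorphism. -/
def seminormOfHom (R : AlgTensor A B →⋆ₙₐ[ℂ] C) : Seminorm ℂ (AlgTensor A B) :=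
  (normSeminorm ℂ C).comp (R : AlgTensor A B →ₗ[ℂ] C)

/-- Pulling back the norm of `C` gives one of the C⋆-seminorms over which the norm is a supremum. -/
theorem norm_hom_le (R : AlgTensor A B →⋆ₙₐ[ℂ] C)
    (hR : ∀ a b, ‖R (AlgTensor.tmul a b)‖ ≤ ‖a‖ * ‖b‖) (x : AlgTensor A B) : ‖R x‖ ≤ ‖x‖ := by
  have h : AlgTensor.IsCStarSeminorm (seminormOfHom R) :=
    { mul_le := fun x y => by
        change ‖R (x * y)‖ ≤ ‖R x‖ * ‖R y‖
        rw [map_mul]; exact norm_mul_le _ _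
      star_mul_self := fun x => by
        change ‖R (star x * x)‖ = ‖R x‖ ^ 2
        rw [map_mul, map_star, CStarRing.norm_star_mul_self, sq]
      tmul_le := hR }
  exact AlgTensor.le_maxNorm ⟨seminormOfHom R, h⟩ x

/-- The extension by continuity of a ⋆-homomorphism to the C⋆-tensor product. -/
def liftL (R : AlgTensor A B →⋆ₙₐ[ℂ] C)
    (hR : ∀ a b, ‖R (AlgTensor.tmul a b)‖ ≤ ‖a‖ * ‖b‖) : CStarTensor A B →L[ℂ] C :=
  ((R : AlgTensor A B →ₗ[ℂ] C).mkContinuous 1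
    (fun x => (norm_hom_le R hR x).trans_eq (one_mul _).symm)).extend
      (UniformSpace.Completion.toComplL (𝕜 := ℂ) (E := AlgTensor A B))

theorem liftL_of (R : AlgTensor A B →⋆ₙₐ[ℂ] C)
    (hR : ∀ a b, ‖R (AlgTensor.tmul a b)‖ ≤ ‖a‖ * ‖b‖) (x : AlgTensor A B) :
    liftL R hR (of x) = R x :=
  ContinuousLinearMap.extend_eq _ UniformSpace.Completion.denseRange_coe
    (UniformSpace.Completion.isUniformInducing_coe _) x

/-- The extension of a ⋆-homomorphism to the C⋆-tensor product. -/
def lift (R : AlgTensor A B →⋆ₙₐ[ℂ] C)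
    (hR : ∀ a b, ‖R (AlgTensor.tmul a b)‖ ≤ ‖a‖ * ‖b‖) : CStarTensor A B →⋆ₙₐ[ℂ] C where
  toFun := liftL R hR
  map_smul' c x := map_smul (liftL R hR) c x
  map_zero' := map_zero (liftL R hR)
  map_add' := map_add (liftL R hR)
  map_mul' x y := by
    refine induction_on₂ x y (isClosed_eq (by fun_prop) (by fun_prop)) fun x y => ?_
    rw [← of_mul, liftL_of, liftL_of, liftL_of, map_mul]
  map_star' x := by
    refine induction_on x (isClosed_eq (by fun_prop) (by fun_prop)) fun x => ?_
    rw [← of_star, liftL_of, liftL_of, map_star]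

theorem lift_of (R : AlgTensor A B →⋆ₙₐ[ℂ] C)
    (hR : ∀ a b, ‖R (AlgTensor.tmul a b)‖ ≤ ‖a‖ * ‖b‖) (x : AlgTensor A B) :
    lift R hR (of x) = R x := liftL_of R hR x

end CStarTensor

/-! ### The representation `π ⊗ id` of `A ⊗ 𝐊` -/

section TensorRep

variable {A : Type*} [NonUnitalCStarAlgebra A]
  {L : Type*} [NormedAddCommGroup L] [InnerProductSpace ℂ L] [CompleteSpace L]
  (K : Type*) [NormedAddCommGroup K] [InnerProductSpace ℂ K] [CompleteSpace K]

/-- The linear map `a ⊗ k ↦ π(a) ⊗ k`. -/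
def algTensorRepₗ (π : A →⋆ₙₐ[ℂ] (L →L[ℂ] L)) :
    AlgTensor A (compactOperators K) →ₗ[ℂ] (HTensor L K →L[ℂ] HTensor L K) :=
  TensorProduct.lift <| LinearMap.mk₂ ℂ (fun a k => HTensor.map (π a) (k : K →L[ℂ] K))
    (fun a a' k => by rw [map_add, HTensor.map_add_left])
    (fun c a k => by rw [map_smul, HTensor.map_smul_left])
    (fun a k k' => HTensor.map_add_right _ _ _)
    (fun c a k => HTensor.map_smul_right _ _ _)

theorem algTensorRepₗ_tmul (π : A →⋆ₙₐ[ℂ] (L →L[ℂ] L)) (a : A) (k : compactOperators K) :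
    algTensorRepₗ K π (AlgTensor.tmul a k) = HTensor.map (π a) (k : K →L[ℂ] K) := rfl

/-- The representation `π ⊗ id` of the algebraic tensor product. -/
def algTensorRep (π : A →⋆ₙₐ[ℂ] (L →L[ℂ] L)) :
    AlgTensor A (compactOperators K) →⋆ₙₐ[ℂ] (HTensor L K →L[ℂ] HTensor L K) where
  toFun := algTensorRepₗ K π
  map_smul' c x := map_smul (algTensorRepₗ K π) c x
  map_zero' := map_zero (algTensorRepₗ K π)
  map_add' := map_add (algTensorRepₗ K π)
  map_mul' x y := by
    induction x using AlgTensor.induction_on with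
    | zero => simp
    | add x x' hx hx' => rw [add_mul, map_add, hx, hx', map_add, add_mul]
    | tmul a k =>
      induction y using AlgTensor.induction_on with
      | zero => simp
      | add y y' hy hy' => rw [mul_add, map_add, hy, hy', map_add, mul_add]
      | tmul b l =>
        rw [AlgTensor.tmul_mul_tmul, algTensorRepₗ_tmul, algTensorRepₗ_tmul, algTensorRepₗ_tmul,
          map_mul]
        exact (HTensor.map_comp _ _ _ _).symm
  map_star' x := by
    induction x using AlgTensor.induction_on with
    | zero => simp
    | add x x' hx hx' => rw [star_add, map_add, hx, hx', map_add, star_add]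
    | tmul a k =>
      rw [AlgTensor.star_tmul, algTensorRepₗ_tmul, algTensorRepₗ_tmul, map_star]
      exact (HTensor.adjoint_map _ _).symm

theorem norm_algTensorRep_tmul_le (π : A →⋆ₙₐ[ℂ] (L →L[ℂ] L)) (a : A) (k : compactOperators K) :
    ‖algTensorRep K π (AlgTensor.tmul a k)‖ ≤ ‖a‖ * ‖k‖ :=
  (HTensor.norm_map_le _ _).trans
    (mul_le_mul_of_nonneg_right (NonUnitalStarAlgHom.norm_apply_le π a) (norm_nonneg _))

/-- The representation `π ⊗ id` of `A ⊗ 𝐊`. -/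
def tensorRep (π : A →⋆ₙₐ[ℂ] (L →L[ℂ] L)) :
    CStarTensor A (compactOperators K) →⋆ₙₐ[ℂ] (HTensor L K →L[ℂ] HTensor L K) :=
  CStarTensor.lift (algTensorRep K π) (norm_algTensorRep_tmul_le K π)

@[simp] theorem tensorRep_tmul (π : A →⋆ₙₐ[ℂ] (L →L[ℂ] L)) (a : A) (k : compactOperators K) :
    tensorRep K π (CStarTensor.tmul a k) = HTensor.map (π a) (k : K →L[ℂ] K) :=
  CStarTensor.lift_of _ _ _

end TensorRep

end

/-! ### Separating positive functionals -/

noncomputable section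

section Functional

open scoped ComplexOrder

variable {A : Type*} [NonUnitalCStarAlgebra A] [PartialOrder A] [StarOrderedRing A]

/-- The point `-a` lies outside the closed convex cone of positive elements, so a real functional
`g` that is nonnegative on the cone is negative at `-a`. -/
theorem exists_positiveLinearMap_ne_zero {a : A} (ha : 0 ≤ a) (ha0 : a ≠ 0) :
    ∃ f : A →ₚ[ℂ] ℂ, f a ≠ 0 := by
  let C : ProperCone ℝ A :=
    { carrier := {x | 0 ≤ x}
      add_mem' := fun hx hy => add_nonneg hx hy
      zero_mem' := le_refl (0 : A)
      smul_mem' := fun c x hx => smul_nonneg c.2 hx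
      isClosed' := CStarAlgebra.isClosed_nonneg }
  have hC : -a ∉ C := fun h => ha0 (le_antisymm (neg_nonneg.1 h) ha)
  obtain ⟨g, hg, hga⟩ := C.hyperplane_separation_point hC
  -- Symmetrizing makes `h` vanish on `i • x` for self-adjoint `x`, so that the complexification `F`
  -- takes the real value `2 g x` there.
  let h : A →ₗ[ℝ] ℝ := g.toLinearMap + g.toLinearMap ∘ₗ (starL' ℝ : A ≃L[ℝ] A).toLinearMap
  have hh (x : A) : h x = g x + g (star x) := rfl
  let F : A →ₗ[ℂ] ℂ := Module.Dual.extendRCLike h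
  have hF (x : A) (hx : IsSelfAdjoint x) : F x = ((2 * g x : ℝ) : ℂ) := by
    have hI : h (Complex.I • x) = 0 := by
      rw [hh, star_smul, hx.star_eq]
      simp
    have : F x = (h x : ℂ) - Complex.I * (h (Complex.I • x) : ℂ) := Module.Dual.extendRCLike_apply h x
    rw [this, hI, hh, hx.star_eq]
    push_cast; ring
  refine ⟨PositiveLinearMap.mk₀ F fun x hx => ?_, ?_⟩
  · rw [hF x hx.isSelfAdjoint]
    have : 0 ≤ g x := hg x hx
    exact_mod_cast (by positivity : 0 ≤ 2 * g x)
  · change F a ≠ 0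
    rw [hF a ha.isSelfAdjoint]
    rw [map_neg] at hga
    exact_mod_cast (by linarith : 2 * g a ≠ 0)

omit [PartialOrder A] [StarOrderedRing A] in
theorem exists_representation_ne_zero {A : Type u} [NonUnitalCStarAlgebra A] {a : A} (ha : a ≠ 0) :
    ∃ (L : Type u) (_ : NormedAddCommGroup L) (_ : InnerProductSpace ℂ L) (_ : CompleteSpace L)
      (π : A →⋆ₙₐ[ℂ] (L →L[ℂ] L)), π a ≠ 0 := by
  let _ : PartialOrder A := CStarAlgebra.spectralOrder A
  have _ : StarOrderedRing A := CStarAlgebra.spectralOrderedRing A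
  -- Without a unit there is no evident cyclic vector. The class of `star a` serves: `π a` sends it
  -- to the class of `c`, whose squared norm is `f (star c * c)`, so `f` is chosen nonzero at this
  -- positive element.
  set c := a * star a
  have hc : c ≠ 0 := (CStarRing.mul_star_self_ne_zero_iff a).2 ha
  obtain ⟨f, hf⟩ := exists_positiveLinearMap_ne_zero (star_mul_self_nonneg c)
    ((CStarRing.star_mul_self_ne_zero_iff c).2 hc)
  refine ⟨f.GNS, inferInstance, inferInstance, inferInstance, f.gnsNonUnitalStarAlgHom, fun h => ?_⟩
  have h1 : ((f.toPreGNS c : f.PreGNS) : f.GNS) = 0 := by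
    have := congr($h ((f.toPreGNS (star a) : f.PreGNS) : f.GNS))
    rw [PositiveLinearMap.gnsNonUnitalStarAlgHom_apply_coe] at this
    exact this
  have h2 : ‖f.toPreGNS c‖ = 0 := by rw [← UniformSpace.Completion.norm_coe, h1, norm_zero]
  have h3 := f.preGNS_norm_sq (f.toPreGNS c)
  rw [h2] at h3
  exact hf (by simpa using h3.symm)

end Functional

/-! ### Rank one operators and the corner `A ⊗ p` -/

section Corner

variable {A : Type*} [NonUnitalCStarAlgebra A]
  {K : Type*} [NormedAddCommGroup K] [InnerProductSpace ℂ K] [CompleteSpace K]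

omit [CompleteSpace K] in
theorem isCompactOperator_rankOne (x y : K) :
    IsCompactOperator (InnerProductSpace.rankOne ℂ x y : K →L[ℂ] K) := by
  rw [InnerProductSpace.rankOne_def']
  have h : IsCompactOperator (innerSL ℂ y) := isCompactOperator_of_locallyCompactSpace_dom _
  exact h.clm_comp (ContinuousLinearMap.toSpanSingleton ℂ x)

/-- The rank one operator `z ↦ ⟨y, z⟩ x` as a compact operator. -/
def compactRankOne (x y : K) : compactOperators K :=
  ⟨InnerProductSpace.rankOne ℂ x y, isCompactOperator_rankOne x y⟩

theorem coe_compactRankOne (x y : K) :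
    (compactRankOne x y : K →L[ℂ] K) = InnerProductSpace.rankOne ℂ x y := rfl

theorem norm_compactRankOne (x y : K) : ‖compactRankOne x y‖ = ‖x‖ * ‖y‖ :=
  InnerProductSpace.norm_rankOne x y

theorem star_compactRankOne (x y : K) : star (compactRankOne x y) = compactRankOne y x :=
  Subtype.ext (InnerProductSpace.adjoint_rankOne x y)

theorem mul_compactRankOne (k : compactOperators K) (x y : K) :
    k * compactRankOne x y = compactRankOne ((k : K →L[ℂ] K) x) y :=
  Subtype.ext <| by ext z; simp [compactRankOne]

theorem compactRankOne_mul_compactRankOne (x y z w : K) :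
    compactRankOne x y * compactRankOne z w = ⟪y, z⟫_ℂ • compactRankOne x w :=
  Subtype.ext <| by ext v; simp [compactRankOne, smul_smul, mul_comm]

theorem compactRankOne_mul_self {e : K} (he : ‖e‖ = 1) :
    compactRankOne e e * compactRankOne e e = compactRankOne e e := by
  rw [compactRankOne_mul_compactRankOne, inner_self_eq_norm_sq_to_K, he]; simp

variable (A) in
/-- The embedding `a ↦ a ⊗ p` of `A` in `A ⊗ 𝐊`, `p` the projection onto the unit vector `e`. -/
def cornerHom {e : K} (he : ‖e‖ = 1) : A →⋆ₙₐ[ℂ] CStarTensor A (compactOperators K) where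
  toFun a := CStarTensor.tmul a (compactRankOne e e)
  map_smul' c a := CStarTensor.smul_tmul c a _
  map_zero' := by simpa using CStarTensor.smul_tmul (0 : ℂ) (0 : A) (compactRankOne e e)
  map_add' a a' := CStarTensor.add_tmul a a' _
  map_mul' a a' := by rw [CStarTensor.tmul_mul_tmul, compactRankOne_mul_self he]
  map_star' a := by rw [CStarTensor.star_tmul, star_compactRankOne]

theorem cornerHom_apply {e : K} (he : ‖e‖ = 1) (a : A) :
    cornerHom A he a = CStarTensor.tmul a (compactRankOne e e) := rfl

/-- If `π a ≠ 0`, then `π ⊗ id` maps `a ⊗ p` to `π(a) ⊗ p`, which has norm `‖π a‖`. -/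
theorem cornerHom_injective {e : K} (he : ‖e‖ = 1) : Function.Injective (cornerHom A he) := by
  rw [injective_iff_map_eq_zero]
  intro a h
  by_contra ha
  obtain ⟨L, _, _, _, π, hπ⟩ := exists_representation_ne_zero ha
  have h1 := congr(tensorRep K π $h)
  rw [cornerHom_apply, tensorRep_tmul, map_zero, coe_compactRankOne] at h1
  have h2 := HTensor.norm_map_rankOne he (π a)
  rw [h1, norm_zero] at h2
  exact hπ (norm_eq_zero.1 h2.symm)

theorem isometry_cornerHom {e : K} (he : ‖e‖ = 1) : Isometry (cornerHom A he) :=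
  NonUnitalStarAlgHom.isometry _ (cornerHom_injective he)

end Corner

end

/-! ### Compressions of representations are completely positive -/

noncomputable section

section Reflect

variable {A B : Type*} [NonUnitalCStarAlgebra A] [PartialOrder A] [StarOrderedRing A]
  [NonUnitalCStarAlgebra B] [PartialOrder B] [StarOrderedRing B]

/-- The functional calculus commutes with `θ`, so the negative part of `a` is mapped to that of `θ
a`, which is zero. -/
theorem NonUnitalStarAlgHom.nonneg_of_map_nonneg (θ : A →⋆ₙₐ[ℂ] B) (hθ : Function.Injective θ)
    {a : A} (h : 0 ≤ θ a) : 0 ≤ a := by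
  have ha : IsSelfAdjoint a := hθ (by rw [map_star, h.isSelfAdjoint.star_eq])
  have hc : Continuous θ := (NonUnitalStarAlgHom.isometry θ hθ).continuous
  rw [← CFC.negPart_eq_zero_iff a ha]
  apply hθ
  rw [map_zero, CFC.negPart_def, NonUnitalStarAlgHom.map_cfcₙ θ _ a (hφa := h.isSelfAdjoint),
    ← CFC.negPart_def, CFC.negPart_eq_zero_iff _ h.isSelfAdjoint]
  exact h

theorem CStarMatrix.nonneg_of_map_nonneg (θ : A →⋆ₙₐ[ℂ] B) (hθ : Function.Injective θ)
    {n : Type*} [Fintype n] {M : CStarMatrix n n A} {G : CStarMatrix n n B}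
    (h : ∀ i j, θ (M i j) = (star G * G) i j) : 0 ≤ M := by
  refine NonUnitalStarAlgHom.nonneg_of_map_nonneg (CStarMatrix.mapₙₐ θ) ?_ ?_
  · intro M N hMN
    ext i j
    exact hθ (congrFun (congrFun hMN i) j)
  · have : CStarMatrix.mapₙₐ θ M = star G * G := by ext i j; exact h i j
    rw [this]
    exact star_mul_self_nonneg G

end Reflect

section Compression

variable {K L : Type*} [NormedAddCommGroup K] [InnerProductSpace ℂ K] [CompleteSpace K]
  [NormedAddCommGroup L] [InnerProductSpace ℂ L] [CompleteSpace L]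

/-- The ⋆-homomorphism `T ↦ J T J⋆` for an isometry `J`. -/
def conjHom (J : K →L[ℂ] L) (hJ : J.adjoint ∘L J = ContinuousLinearMap.id ℂ K) :
    (K →L[ℂ] K) →⋆ₙₐ[ℂ] (L →L[ℂ] L) where
  toFun T := J ∘L T ∘L J.adjoint
  map_smul' c T := by ext; simp
  map_zero' := by ext; simp
  map_add' S T := by ext; simp
  map_mul' S T := by
    ext x
    have h (y : K) : J.adjoint (J y) = y := congr($hJ y)
    simp [h]
  map_star' T := by
    simp only [ContinuousLinearMap.star_eq_adjoint, ContinuousLinearMap.adjoint_comp,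
      ContinuousLinearMap.adjoint_adjoint]
    rfl

theorem conjHom_injective (J : K →L[ℂ] L) (hJ : J.adjoint ∘L J = ContinuousLinearMap.id ℂ K) :
    Function.Injective (conjHom J hJ) := by
  have h (y : K) : J.adjoint (J y) = y := congr($hJ y)
  intro S T hST
  ext x
  have := congr(J.adjoint ($hST (J x)))
  simpa [conjHom, h] using this

/-- The inclusion of the first summand in the Hilbert sum. -/
def hilbertInl (K L : Type*) [NormedAddCommGroup K] [InnerProductSpace ℂ K]
    [NormedAddCommGroup L] [InnerProductSpace ℂ L] : K →L[ℂ] WithLp 2 (K × L) :=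
  (WithLp.prodContinuousLinearEquiv 2 ℂ K L).symm.toContinuousLinearMap ∘L
    ContinuousLinearMap.inl ℂ K L

/-- The inclusion of the second summand in the Hilbert sum. -/
def hilbertInr (K L : Type*) [NormedAddCommGroup K] [InnerProductSpace ℂ K]
    [NormedAddCommGroup L] [InnerProductSpace ℂ L] : L →L[ℂ] WithLp 2 (K × L) :=
  (WithLp.prodContinuousLinearEquiv 2 ℂ K L).symm.toContinuousLinearMap ∘L
    ContinuousLinearMap.inr ℂ K L

theorem adjoint_hilbertInl_comp :
    (hilbertInl K L).adjoint ∘L hilbertInl K L = ContinuousLinearMap.id ℂ K := by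
  ext x
  refine ext_inner_left ℂ fun y => ?_
  simp [ContinuousLinearMap.adjoint_inner_right, hilbertInl, WithLp.prod_inner_apply]

theorem adjoint_hilbertInr_comp :
    (hilbertInr K L).adjoint ∘L hilbertInr K L = ContinuousLinearMap.id ℂ L := by
  ext x
  refine ext_inner_left ℂ fun y => ?_
  simp [ContinuousLinearMap.adjoint_inner_right, hilbertInr, WithLp.prod_inner_apply]

/-- The operators `R k j` connect two different spaces, so they are not entries over one C⋆-algebra.
In `B(K ⊕ L)` they are: conjugating `M` entrywise by the inclusion `J` gives `G⋆G` with `G k j = J'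
(R k j) J⋆`, and positivity descends because the conjugation is injective. -/
theorem CStarMatrix.nonneg_of_eq_sum_adjoint_comp {n : Type*} [Fintype n]
    {M : CStarMatrix n n (K →L[ℂ] K)} (R : n → n → K →L[ℂ] L)
    (h : ∀ i j, M i j = ∑ k, (R k i).adjoint ∘L R k j) : 0 ≤ M := by
  let J := hilbertInl K L
  let J' := hilbertInr K L
  have hJ' (y : L) : J'.adjoint (J' y) = y := congr($(adjoint_hilbertInr_comp (K := K) (L := L)) y)
  let g : n → n → WithLp 2 (K × L) →L[ℂ] WithLp 2 (K × L) := fun k j => J' ∘L R k j ∘L J.adjoint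
  refine CStarMatrix.nonneg_of_map_nonneg (conjHom J adjoint_hilbertInl_comp)
    (conjHom_injective J _) (G := CStarMatrix.ofMatrix g) fun i j => ?_
  have h1 : (star (CStarMatrix.ofMatrix g) * CStarMatrix.ofMatrix g) i j
      = ∑ k, (g k i).adjoint ∘L g k j := rfl
  rw [h1, h, map_sum]
  refine Finset.sum_congr rfl fun k _ => ?_
  ext x
  simp [conjHom, g, ContinuousLinearMap.adjoint_comp, hJ']

variable {B : Type*} [NonUnitalCStarAlgebra B] [PartialOrder B] [StarOrderedRing B]

/-- The compression `b ↦ W⋆ρ(b)W` of a representation. -/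
def cpCompression (ρ : B →⋆ₙₐ[ℂ] (L →L[ℂ] L)) (W : K →L[ℂ] L) : B →CP (K →L[ℂ] K) where
  toFun b := W.adjoint ∘L ρ b ∘L W
  map_add' b c := by ext; simp
  map_smul' c b := by ext; simp
  map_cstarMatrix_nonneg' k M hM := by
    obtain ⟨N, rfl⟩ := CStarMatrix.nonneg_iff_exists_star_mul_self.1 hM
    -- For `M = N⋆N` the `(i, j)` entry of the image is `∑ l, (ρ(N l i)W)⋆(ρ(N l j)W)`.
    refine CStarMatrix.nonneg_of_eq_sum_adjoint_comp (fun l j => ρ (N l j) ∘L W) fun i j => ?_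
    have h1 : (star N * N) i j = ∑ l, star (N l i) * N l j := rfl
    change W.adjoint ∘L ρ ((star N * N) i j) ∘L W = _
    have h2 (b : B) : ρ (star b) = (ρ b).adjoint := map_star ρ b
    rw [h1]
    ext x
    simp [ContinuousLinearMap.adjoint_comp, sum_apply, h2]

theorem cpCompression_apply (ρ : B →⋆ₙₐ[ℂ] (L →L[ℂ] L)) (W : K →L[ℂ] L) (b : B) :
    cpCompression ρ W b = W.adjoint ∘L ρ b ∘L W := rfl

end Compression

end

/-! ### Density of the finite rank operators -/

noncomputable section

section FiniteRank

variable {K : Type*} [NormedAddCommGroup K] [InnerProductSpace ℂ K] [CompleteSpace K]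

omit [CompleteSpace K] in
-- Let `F` be spanned by a finite `ε`-net of the image of the unit ball. For a net point `z` near
-- `Tx`, `(1 - P)Tx = (1 - P)(Tx - z)` since `Pz = z`.
theorem exists_starProjection_comp_near {T : K →L[ℂ] K} (hT : IsCompactOperator T) {ε : ℝ}
    (hε : 0 < ε) : ∃ (F : Submodule ℂ K) (_ : FiniteDimensional ℂ F),
      ‖T - F.starProjection ∘L T‖ ≤ ε := by
  have htb : TotallyBounded (T '' Metric.closedBall 0 1) :=
    (hT.isCompact_closure_image_closedBall (f := (T : K →ₗ[ℂ] K)) 1).totallyBounded.subset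
      subset_closure
  obtain ⟨t, ht, hcov⟩ := Metric.totallyBounded_iff.1 htb ε hε
  have hF : FiniteDimensional ℂ (Submodule.span ℂ t) := FiniteDimensional.span_of_finite ℂ ht
  refine ⟨Submodule.span ℂ t, hF, ContinuousLinearMap.opNorm_le_of_unit_norm hε.le fun x hx => ?_⟩
  have h := hcov ⟨x, by simp [hx], rfl⟩
  simp only [Set.mem_iUnion] at h
  obtain ⟨z, hz, hxz⟩ := h
  have hPz : (Submodule.span ℂ t).starProjection z = z :=
    Submodule.starProjection_eq_self_iff.2 (Submodule.subset_span hz)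
  have h1 : (T - (Submodule.span ℂ t).starProjection ∘L T) x
      = (Submodule.span ℂ t)ᗮ.starProjection (T x - z) := by
    rw [Submodule.starProjection_orthogonal]
    simp [hPz]
  rw [h1]
  refine (ContinuousLinearMap.le_of_opNorm_le _ (Submodule.starProjection_norm_le _) _).trans ?_
  rw [one_mul, ← dist_eq_norm]
  exact (Metric.mem_ball.1 hxz).le

theorem span_compactRankOne :
    (Submodule.span ℂ {k : compactOperators K | ∃ x y, compactRankOne x y = k}).topologicalClosure
      = ⊤ := by
  refine (Submodule.eq_top_iff' (p := _)).2 fun T => ?_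
  rw [← SetLike.mem_coe, Submodule.topologicalClosure_coe, Metric.mem_closure_iff]
  intro ε hε
  obtain ⟨F, hF, hle⟩ := exists_starProjection_comp_near T.2 (half_pos hε)
  let b := stdOrthonormalBasis ℂ F
  -- For an orthonormal basis `b` of `F`, the operator `PT` is `∑ |bᵢ⟩⟨T⋆bᵢ|`.
  refine ⟨∑ i, compactRankOne (b i : K) ((T : K →L[ℂ] K).adjoint (b i)),
    Submodule.sum_mem _ fun i _ => Submodule.subset_span ⟨_, _, rfl⟩, ?_⟩
  have h : ((∑ i, compactRankOne (b i : K) ((T : K →L[ℂ] K).adjoint (b i)) :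
      compactOperators K) : K →L[ℂ] K) = F.starProjection ∘L (T : K →L[ℂ] K) := by
    rw [b.starProjection_eq_sum_rankOne]
    ext x
    simp [compactRankOne, sum_apply, ContinuousLinearMap.adjoint_inner_left]
  rw [dist_eq_norm]
  change ‖(T : K →L[ℂ] K) - _‖ < ε
  rw [h]
  linarith

end FiniteRank

end

/-! ### The equivalence bimodule between `A` and `A ⊗ 𝐊` -/

noncomputable section

section Bimodule

variable {A : Type*} [NonUnitalCStarAlgebra A]
  {K : Type*} [NormedAddCommGroup K] [InnerProductSpace ℂ K] [CompleteSpace K]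

variable (A) in
/-- The row space `A ⊗ |e⟩⟨K|` in `A ⊗ 𝐊`, which is `p(A ⊗ 𝐊)` for `p` the projection onto `e`. -/
def cornerRow (e : K) : Submodule ℂ (CStarTensor A (compactOperators K)) :=
  (Submodule.span ℂ {x | ∃ a y, CStarTensor.tmul a (compactRankOne e y) = x}).topologicalClosure

theorem tmul_mem_cornerRow (e : K) (a : A) (y : K) :
    CStarTensor.tmul a (compactRankOne e y) ∈ cornerRow A e :=
  Submodule.le_topologicalClosure _ (Submodule.subset_span ⟨a, y, rfl⟩)

theorem isClosed_cornerRow (e : K) :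
    IsClosed (cornerRow A e : Set (CStarTensor A (compactOperators K))) :=
  Submodule.isClosed_topologicalClosure _

instance (e : K) : CompleteSpace (cornerRow A e) := (isClosed_cornerRow e).completeSpace_coe

theorem cornerRow_le {e : K} {N : Submodule ℂ (CStarTensor A (compactOperators K))}
    (hN : IsClosed (N : Set (CStarTensor A (compactOperators K))))
    (h : ∀ a y, CStarTensor.tmul a (compactRankOne e y) ∈ N) : cornerRow A e ≤ N :=
  Submodule.topologicalClosure_minimal _ (Submodule.span_le.2 (by rintro _ ⟨a, y, rfl⟩; exact h a y))
    hN

theorem star_coe_compactOperators (k : compactOperators K) :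
    ((star k : compactOperators K) : K →L[ℂ] K) = (k : K →L[ℂ] K).adjoint := rfl

theorem compactRankOne_mul (x y : K) (k : compactOperators K) :
    compactRankOne x y * k = compactRankOne x ((k : K →L[ℂ] K).adjoint y) := by
  rw [← star_inj, star_mul, star_compactRankOne, star_compactRankOne, mul_compactRankOne,
    star_coe_compactOperators]

theorem mul_mem_cornerRow {e : K} {x : CStarTensor A (compactOperators K)}
    (hx : x ∈ cornerRow A e) (b : CStarTensor A (compactOperators K)) : x * b ∈ cornerRow A e := by
  let f := (ContinuousLinearMap.mul ℂ (CStarTensor A (compactOperators K))).flip b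
  refine cornerRow_le (N := (cornerRow A e).comap f.toLinearMap)
    ((isClosed_cornerRow e).preimage f.continuous) (fun a y => ?_) hx
  let g := ContinuousLinearMap.mul ℂ _ (CStarTensor.tmul a (compactRankOne e y))
  refine CStarTensor.mem_of_forall_tmul (M := (cornerRow A e).comap g.toLinearMap)
    ((isClosed_cornerRow e).preimage g.continuous) (fun a' k => ?_) b
  change CStarTensor.tmul a (compactRankOne e y) * CStarTensor.tmul a' k ∈ cornerRow A e
  rw [CStarTensor.tmul_mul_tmul, compactRankOne_mul]
  exact tmul_mem_cornerRow _ _ _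

variable {e : K} (he : ‖e‖ = 1)
include he

theorem cornerHom_mul_mem_cornerRow (a : A) {x : CStarTensor A (compactOperators K)}
    (hx : x ∈ cornerRow A e) : cornerHom A he a * x ∈ cornerRow A e := by
  let g := ContinuousLinearMap.mul ℂ _ (cornerHom A he a)
  refine cornerRow_le (N := (cornerRow A e).comap g.toLinearMap)
    ((isClosed_cornerRow e).preimage g.continuous) (fun a' y => ?_) hx
  change cornerHom A he a * CStarTensor.tmul a' (compactRankOne e y) ∈ cornerRow A e
  rw [cornerHom_apply, CStarTensor.tmul_mul_tmul, mul_compactRankOne]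
  rw [coe_compactRankOne, InnerProductSpace.rankOne_apply, inner_self_eq_one_of_norm_eq_one he,
    one_smul]
  exact tmul_mem_cornerRow _ _ _

theorem tmul_mul_star_tmul_cornerRow (a a' : A) (y y' : K) :
    CStarTensor.tmul a (compactRankOne e y) * star (CStarTensor.tmul a' (compactRankOne e y'))
      = cornerHom A he (⟪y, y'⟫_ℂ • (a * star a')) := by
  rw [CStarTensor.star_tmul, star_compactRankOne, CStarTensor.tmul_mul_tmul,
    compactRankOne_mul_compactRankOne, CStarTensor.tmul_smul, map_smul, cornerHom_apply]

/-- The corner is the range of an isometry, hence closed, so each variable may be restricted to the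
generators of the row. There the product is `⟨y, y'⟩ aa'⋆ ⊗ p`. -/
theorem exists_cornerHom_eq_mul_star {x y : CStarTensor A (compactOperators K)}
    (hx : x ∈ cornerRow A e) (hy : y ∈ cornerRow A e) :
    ∃ a, cornerHom A he a = x * star y := by
  let N : Submodule ℂ (CStarTensor A (compactOperators K)) :=
    LinearMap.range (cornerHom A he : A →ₗ[ℂ] CStarTensor A (compactOperators K))
  have hN : IsClosed (N : Set (CStarTensor A (compactOperators K))) :=
    (isometry_cornerHom he).isClosedEmbedding.isClosed_range
  let f := (ContinuousLinearMap.mul ℂ (CStarTensor A (compactOperators K))).flip (star y)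
  refine cornerRow_le (N := N.comap f.toLinearMap) (hN.preimage f.continuous) (fun a z => ?_) hx
  let g : CStarTensor A (compactOperators K) →L⋆[ℂ] CStarTensor A (compactOperators K) :=
    (ContinuousLinearMap.mul ℂ _ (CStarTensor.tmul a (compactRankOne e z))).comp
      (starL ℂ : CStarTensor A (compactOperators K) ≃L⋆[ℂ] _).toContinuousLinearMap
  refine cornerRow_le (N := N.comap g.toLinearMap) (hN.preimage g.continuous)
    (fun a' z' => ?_) hy
  exact ⟨_, (tmul_mul_star_tmul_cornerRow he a a' z z').symm⟩

/-- The `A`-valued inner product on the row space. -/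
def cornerInner (x y : cornerRow A e) : A := (exists_cornerHom_eq_mul_star he x.2 y.2).choose

theorem cornerHom_cornerInner (x y : cornerRow A e) :
    cornerHom A he (cornerInner he x y)
      = (x : CStarTensor A (compactOperators K)) * star (y : CStarTensor A (compactOperators K)) :=
  (exists_cornerHom_eq_mul_star he x.2 y.2).choose_spec

omit he in
-- A C⋆-algebra is the linear span of its positive elements, each of the form `b⋆b`. Both fullness
-- conditions rest on this.
theorem mem_of_forall_star_mul (M : Submodule ℂ A) (h : ∀ b, star b * b ∈ M) (a : A) : a ∈ M := by
  let _ : PartialOrder A := CStarAlgebra.spectralOrder A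
  have _ : StarOrderedRing A := CStarAlgebra.spectralOrderedRing A
  have h1 : Submodule.span ℂ {a : A | 0 ≤ a} ≤ M := Submodule.span_le.2 fun a ha => by
    obtain ⟨b, rfl⟩ := NonUnitalCStarAlgebra.nonneg_iff_exists_star_mul_self.1 (show 0 ≤ a from ha)
    exact h b
  rw [CStarAlgebra.span_nonneg] at h1
  exact h1 trivial

omit he in
-- The inner product of `b ⊗ |e⟩⟨y|` and `b ⊗ |e⟩⟨z|` is `b⋆b ⊗ |y⟩⟨z|`. The elements `b⋆b` span
-- `A`, the rank one operators span a dense subspace of `𝐊`, and `k ↦ b⋆b ⊗ k` is continuous.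
theorem cornerRow_rinner_full (he : ‖e‖ = 1) :
    (Submodule.span ℂ {b : CStarTensor A (compactOperators K) | ∃ x y : cornerRow A e,
      star (x : CStarTensor A (compactOperators K)) * y = b}).topologicalClosure = ⊤ := by
  set M := (Submodule.span ℂ {b : CStarTensor A (compactOperators K) | ∃ x y : cornerRow A e,
      star (x : CStarTensor A (compactOperators K)) * y = b}).topologicalClosure with hM
  have hMc : IsClosed (M : Set (CStarTensor A (compactOperators K))) :=
    Submodule.isClosed_topologicalClosure _
  refine (Submodule.eq_top_iff' (p := M)).2 fun x => CStarTensor.mem_of_forall_tmul hMc ?_ x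
  intro a k
  let t : A →ₗ[ℂ] CStarTensor A (compactOperators K) :=
    { toFun := fun a => CStarTensor.tmul a k
      map_add' := fun a a' => CStarTensor.add_tmul a a' k
      map_smul' := fun c a => CStarTensor.smul_tmul c a k }
  refine mem_of_forall_star_mul (M.comap t) (fun b => ?_) a
  let s : compactOperators K →L[ℂ] CStarTensor A (compactOperators K) :=
    LinearMap.mkContinuous
      { toFun := fun k => CStarTensor.tmul (star b * b) k
        map_add' := fun k k' => CStarTensor.tmul_add _ k k'
        map_smul' := fun c k => CStarTensor.tmul_smul c _ k } ‖star b * b‖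
      (fun k => CStarTensor.norm_tmul_le _ k)
  have hs : Submodule.span ℂ {k : compactOperators K | ∃ x y, compactRankOne x y = k}
      ≤ M.comap s.toLinearMap := Submodule.span_le.2 <| by
    rintro _ ⟨y, z, rfl⟩
    refine Submodule.le_topologicalClosure _ (Submodule.subset_span
      ⟨⟨_, tmul_mem_cornerRow e b y⟩, ⟨_, tmul_mem_cornerRow e b z⟩, ?_⟩)
    change star (CStarTensor.tmul b (compactRankOne e y)) * CStarTensor.tmul b (compactRankOne e z)
      = CStarTensor.tmul (star b * b) (compactRankOne y z)
    rw [CStarTensor.star_tmul, star_compactRankOne, CStarTensor.tmul_mul_tmul,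
      compactRankOne_mul_compactRankOne, inner_self_eq_one_of_norm_eq_one he, one_smul]
  have hs' := Submodule.topologicalClosure_minimal _ hs (hMc.preimage s.continuous)
  rw [span_compactRankOne] at hs'
  exact hs' (x := k) trivial

/-- The equivalence bimodule between `A` and `A ⊗ 𝐊`. -/
def cornerBimodule [PartialOrder A] [StarOrderedRing A] :
    EquivalenceBimodule A (CStarTensor A (compactOperators K)) (cornerRow A e) where
  lsmul := LinearMap.mk₂ ℂ
    (fun a x => ⟨cornerHom A he a * x, cornerHom_mul_mem_cornerRow he a x.2⟩)
    (fun a a' x => Subtype.ext (by simp [add_mul]))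
    (fun c a x => Subtype.ext (by simp [smul_mul_assoc]))
    (fun a x y => Subtype.ext (by simp [mul_add]))
    (fun c a x => Subtype.ext (by simp [mul_smul_comm]))
  rsmul := LinearMap.mk₂ ℂ (fun b x => ⟨x * b, mul_mem_cornerRow x.2 b⟩)
    (fun b b' x => Subtype.ext (by simp [mul_add]))
    (fun c b x => Subtype.ext (by simp [mul_smul_comm]))
    (fun b x y => Subtype.ext (by simp [add_mul]))
    (fun c b x => Subtype.ext (by simp [smul_mul_assoc]))
  -- Identities for the left inner product are checked after the injective embedding `a ↦ a ⊗ p`,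
  -- where they become ring identities in `A ⊗ 𝐊`; for instance, both sides of `linner_lsmul_eq` are
  -- `x y⋆ z`.
  linner := LinearMap.mk₂'ₛₗ (RingHom.id ℂ) (starRingEnd ℂ) (cornerInner he)
    (fun x x' y => cornerHom_injective he (by simp [cornerHom_cornerInner, add_mul]))
    (fun c x y => cornerHom_injective he (by simp [cornerHom_cornerInner, smul_mul_assoc]))
    (fun x y y' => cornerHom_injective he (by simp [cornerHom_cornerInner, mul_add]))
    (fun c x y => cornerHom_injective he (by simp [cornerHom_cornerInner, mul_smul_comm]))
  rinner := LinearMap.mk₂'ₛₗ (starRingEnd ℂ) (RingHom.id ℂ)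
    (fun x y => star (x : CStarTensor A (compactOperators K)) * y)
    (fun x x' y => by simp [add_mul])
    (fun c x y => by simp [smul_mul_assoc])
    (fun x y y' => by simp [mul_add])
    (fun c x y => by simp [mul_smul_comm])
  mul_lsmul a a' x := Subtype.ext (by simp [mul_assoc])
  mul_rsmul b b' x := Subtype.ext (by simp [mul_assoc])
  lsmul_rsmul a b x := Subtype.ext (by simp [mul_assoc])
  linner_lsmul a x y := cornerHom_injective he (by simp [cornerHom_cornerInner, mul_assoc])
  rinner_rsmul b x y := by simp [mul_assoc]
  star_linner x y := cornerHom_injective he (by simp [cornerHom_cornerInner, map_star])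
  star_rinner x y := by simp
  linner_self_nonneg x := NonUnitalStarAlgHom.nonneg_of_map_nonneg (cornerHom A he)
    (cornerHom_injective he) (by
      change 0 ≤ cornerHom A he (cornerInner he x x)
      rw [cornerHom_cornerInner]
      exact mul_star_self_nonneg (x : CStarTensor A (compactOperators K)))
  rinner_self_nonneg x := star_mul_self_nonneg (x : CStarTensor A (compactOperators K))
  norm_linner_self x := by
    change ‖cornerInner he x x‖ = _
    rw [← NonUnitalStarAlgHom.norm_map (cornerHom A he) (cornerHom_injective he),
      cornerHom_cornerInner, CStarRing.norm_self_mul_star, ← sq, Submodule.coe_norm]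
  norm_rinner_self x := by
    change ‖star (x : CStarTensor A (compactOperators K)) * x‖ = _
    rw [CStarRing.norm_star_mul_self, ← sq, Submodule.coe_norm]
  linner_full := by
    refine top_unique (le_trans ?_ (Submodule.le_topologicalClosure _))
    intro a _
    refine mem_of_forall_star_mul _ (fun b => ?_) a
    -- With `x = b⋆ ⊗ p` one has `xx⋆ = b⋆b ⊗ p`, so no closure is needed on this side.
    refine Submodule.subset_span
      ⟨⟨_, tmul_mem_cornerRow e (star b) e⟩, ⟨_, tmul_mem_cornerRow e (star b) e⟩, ?_⟩
    refine cornerHom_injective he ?_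
    rw [LinearMap.mk₂'ₛₗ_apply, cornerHom_cornerInner, tmul_mul_star_tmul_cornerRow he,
      inner_self_eq_one_of_norm_eq_one he, one_smul, star_star]
  rinner_full := cornerRow_rinner_full he
  rinner_lsmul a x y := by simp [map_star, mul_assoc]
  linner_rsmul b x y := cornerHom_injective he (by simp [cornerHom_cornerInner, mul_assoc])
  linner_lsmul_eq x y z := Subtype.ext (by simp [cornerHom_cornerInner, mul_assoc])

variable {L : Type*} [NormedAddCommGroup L] [InnerProductSpace ℂ L] [CompleteSpace L]
  (π : A →⋆ₙₐ[ℂ] (L →L[ℂ] L))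

theorem tensorRep_cornerHom (a : A) :
    tensorRep K π (cornerHom A he a)
      = HTensor.inclL L e ∘L π a ∘L (HTensor.inclL L e).adjoint := by
  rw [cornerHom_apply, tensorRep_tmul]
  refine HTensor.clm_ext fun ξ η => ?_
  simp [coe_compactRankOne, HTensor.adjoint_inclL_tmul, HTensor.tmul_smul]

/-- `JJ⋆` is the projection `1 ⊗ p`, and `|e⟩⟨y|` has range in the span of `e`; this settles the
generators, and the condition on `x` is closed. -/
theorem inclL_adjoint_comp_tensorRep {x : CStarTensor A (compactOperators K)}
    (hx : x ∈ cornerRow A e) :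
    HTensor.inclL L e ∘L (HTensor.inclL L e).adjoint ∘L tensorRep K π x = tensorRep K π x := by
  have hc : Continuous (tensorRep K π) := map_continuous (CStarTensor.liftL (algTensorRep K π)
    (norm_algTensorRep_tmul_le K π))
  let P := HTensor.inclL L e ∘L (HTensor.inclL L e).adjoint
  let N : Submodule ℂ (CStarTensor A (compactOperators K)) :=
    { carrier := {x | P ∘L tensorRep K π x = tensorRep K π x}
      add_mem' := fun {x y} hx hy => by
        simp only [Set.mem_ofPred_eq, map_add, ContinuousLinearMap.comp_add] at *
        rw [hx, hy]
      zero_mem' := by simp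
      smul_mem' := fun c x hx => by
        simp only [Set.mem_ofPred_eq, map_smul, ContinuousLinearMap.comp_smul] at *
        rw [hx] }
  have hN : IsClosed (N : Set (CStarTensor A (compactOperators K))) :=
    isClosed_eq ((ContinuousLinearMap.compL ℂ _ _ _ P).continuous.comp hc) hc
  refine cornerRow_le (N := N) hN (fun a y => ?_) hx
  change P ∘L tensorRep K π _ = tensorRep K π _
  rw [tensorRep_tmul]
  refine HTensor.clm_ext fun ξ η => ?_
  simp [P, coe_compactRankOne, HTensor.adjoint_inclL_tmul, HTensor.tmul_smul, he]

/-- The representation `x ↦ J⋆ρ(x)` of the row space, where `Jξ = ξ ⊗ e`. -/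
def cornerRep (e : K) : cornerRow A e →ₗ[ℂ] (HTensor L K →L[ℂ] L) :=
  { toFun := fun x => (HTensor.inclL L e).adjoint ∘L tensorRep K π x
    map_add' := fun x y => by simp
    map_smul' := fun c x => by simp }

theorem isBimoduleRepresentation_cornerRep [PartialOrder A] [StarOrderedRing A]
    (hπ : IsNondegenerate π) (hρ : IsNondegenerate (tensorRep K π)) :
    IsBimoduleRepresentation (cornerBimodule he) π (cornerRep π e) (tensorRep K π) where
  nondegenerate_left := hπ
  nondegenerate_right := hρ
  comp_adjoint x y := by
    have h : tensorRep K π (x : CStarTensor A (compactOperators K)) ∘L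
        (tensorRep K π (y : CStarTensor A (compactOperators K))).adjoint
        = HTensor.inclL L e ∘L π (cornerInner he x y) ∘L (HTensor.inclL L e).adjoint := by
      rw [← tensorRep_cornerHom he, cornerHom_cornerInner, map_mul, map_star]
      rfl
    change ((HTensor.inclL L e).adjoint ∘L tensorRep K π (x : CStarTensor A (compactOperators K)))
      ∘L ((HTensor.inclL L e).adjoint ∘L
        tensorRep K π (y : CStarTensor A (compactOperators K))).adjoint = π (cornerInner he x y)
    have hJ (ξ : L) : (HTensor.inclL L e).adjoint (HTensor.inclL L e ξ) = ξ :=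
      congr($(HTensor.adjoint_inclL_comp_inclL he) ξ)
    ext ξ
    -- Compressing `ρ(x)ρ(y)⋆ = J π(⟨x, y⟩) J⋆` by `J` and using `J⋆J = 1` leaves `π(⟨x, y⟩)`.
    have := congr((HTensor.inclL L e).adjoint ($h (HTensor.inclL L e ξ)))
    simpa only [ContinuousLinearMap.adjoint_comp, ContinuousLinearMap.adjoint_adjoint,
      ContinuousLinearMap.comp_apply, hJ] using this
  adjoint_comp x y := by
    change ((HTensor.inclL L e).adjoint ∘L
        tensorRep K π (x : CStarTensor A (compactOperators K))).adjoint ∘L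
      ((HTensor.inclL L e).adjoint ∘L tensorRep K π (y : CStarTensor A (compactOperators K)))
      = tensorRep K π (star (x : CStarTensor A (compactOperators K)) * y)
    rw [ContinuousLinearMap.adjoint_comp, ContinuousLinearMap.adjoint_adjoint,
      ContinuousLinearMap.comp_assoc, inclL_adjoint_comp_tensorRep he π y.2, map_mul, map_star]
    rfl
  map_smul_smul a x b := by
    change (HTensor.inclL L e).adjoint ∘L tensorRep K π (cornerHom A he a * x * b)
      = π a ∘L ((HTensor.inclL L e).adjoint ∘L
        tensorRep K π (x : CStarTensor A (compactOperators K))) ∘L tensorRep K π b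
    have hJ (ξ : L) : (HTensor.inclL L e).adjoint (HTensor.inclL L e ξ) = ξ :=
      congr($(HTensor.adjoint_inclL_comp_inclL he) ξ)
    rw [map_mul, map_mul, tensorRep_cornerHom he]
    ext ξ
    simp [hJ, -HTensor.inclL_apply]

end Bimodule

end

/-! ### The map `φ ⊗ id`, its minimal Stinespring representation, and the equivalence -/

noncomputable section

section Stabilization

variable {A : Type*} [NonUnitalCStarAlgebra A] [PartialOrder A] [StarOrderedRing A]
  {H : Type*} [NormedAddCommGroup H] [InnerProductSpace ℂ H] [CompleteSpace H]
  (K : Type*) [NormedAddCommGroup K] [InnerProductSpace ℂ K] [CompleteSpace K]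

/-- The operator `V ⊗ 1`, where `V` is the Stinespring operator of `φ`. -/
def stabilizationOp (φ : A →CP (H →L[ℂ] H)) : HTensor H K →L[ℂ] HTensor φ.Dilation K :=
  HTensor.map φ.dilOp (ContinuousLinearMap.id ℂ K)

/-- The completely positive map `φ ⊗ id`. -/
def stabilization (φ : A →CP (H →L[ℂ] H)) :
    CStarTensor A (compactOperators K) →CP (HTensor H K →L[ℂ] HTensor H K) :=
  cpCompression (tensorRep K φ.dilRep) (stabilizationOp K φ)

theorem stabilization_tmul (φ : A →CP (H →L[ℂ] H)) (a : A) (k : compactOperators K) :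
    stabilization K φ (CStarTensor.tmul a k) = HTensor.map (φ a) (k : K →L[ℂ] K) := by
  rw [stabilization, cpCompression_apply, tensorRep_tmul, stabilizationOp, HTensor.adjoint_map,
    HTensor.map_comp, HTensor.map_comp, ContinuousLinearMap.comp_id, φ.dilation_eq]
  congr 1
  ext x
  exact congr($(ContinuousLinearMap.adjoint_id (𝕜 := ℂ) (E := K)) ((k : K →L[ℂ] K) x))

variable {K}

/-- Completely positive maps are automatically continuous, and elementary tensors span a dense
subspace. -/
theorem eq_stabilization {φ : A →CP (H →L[ℂ] H)}
    {Φ : CStarTensor A (compactOperators K) →CP (HTensor H K →L[ℂ] HTensor H K)}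
    (hΦ : ∀ a (k : compactOperators K),
      Φ (CStarTensor.tmul a k) = HTensor.map (φ a) (k : K →L[ℂ] K)) :
    Φ = stabilization K φ := by
  let F : CStarTensor A (compactOperators K) →L[ℂ] (HTensor H K →L[ℂ] HTensor H K) :=
    ⟨Φ.toLinearMap, map_continuous Φ⟩
  let G : CStarTensor A (compactOperators K) →L[ℂ] (HTensor H K →L[ℂ] HTensor H K) :=
    ⟨(stabilization K φ).toLinearMap, map_continuous (stabilization K φ)⟩
  have h : F = G := CStarTensor.clm_ext fun a k =>
    (hΦ a k).trans (stabilization_tmul K φ a k).symm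
  exact DFunLike.ext _ _ fun x => congr($h x)

theorem span_tensorRep_stabilizationOp (φ : A →CP (H →L[ℂ] H)) {e : K} (he : ‖e‖ = 1) :
    (Submodule.span ℂ {η | ∃ b ξ, tensorRep K φ.dilRep b (stabilizationOp K φ ξ) = η}
      ).topologicalClosure = ⊤ := by
  set M := (Submodule.span ℂ {η | ∃ b ξ, tensorRep K φ.dilRep b (stabilizationOp K φ ξ) = η}
      ).topologicalClosure
  have hM : IsClosed (M : Set (HTensor φ.Dilation K)) := Submodule.isClosed_topologicalClosure _
  refine (Submodule.eq_top_iff' (p := M)).2 fun x => HTensor.mem_of_forall_tmul hM ?_ x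
  intro ζ η
  have h : Submodule.span ℂ {ζ : φ.Dilation | ∃ a ξ, φ.dilTmul a ξ = ζ}
      ≤ M.comap (HTensor.inclL φ.Dilation η).toLinearMap := Submodule.span_le.2 <| by
    rintro _ ⟨a, ξ, rfl⟩
    -- The operator `|η⟩⟨e|` moves `e` to `η`, so `a ⊗ |η⟩⟨e|` applied to `Vξ ⊗ e` gives `π(a)Vξ ⊗
    -- η`.
    refine Submodule.le_topologicalClosure _ (Submodule.subset_span
      ⟨CStarTensor.tmul a (compactRankOne η e), HTensor.tmul ξ e, ?_⟩)
    simp [stabilizationOp, coe_compactRankOne, he, φ.dilRep_dilOp]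
  have h' := Submodule.topologicalClosure_minimal _ h
    (hM.preimage (HTensor.inclL φ.Dilation η).continuous)
  rw [φ.span_dilTmul] at h'
  exact h' (x := ζ) trivial

omit [CompleteSpace K] in
theorem norm_stabilizationOp_le (φ : A →CP (H →L[ℂ] H)) :
    ‖stabilizationOp K φ‖ ≤ ‖φ.dilOp‖ :=
  (HTensor.norm_map_le _ _).trans
    (mul_le_of_le_one_right (norm_nonneg φ.dilOp) ContinuousLinearMap.norm_id_le)

theorem isMinimalStinespring_stabilization (φ : A →CP (H →L[ℂ] H)) {e : K} (he : ‖e‖ = 1) :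
    IsMinimalStinespring (stabilization K φ) (tensorRep K φ.dilRep) (stabilizationOp K φ) where
  dilation _ := rfl
  norm_sq := by
    constructor
    · rintro _ ⟨b, hb, rfl⟩
      exact norm_adjoint_comp_comp_le _ _
        ((NonUnitalStarAlgHom.norm_apply_le (tensorRep K φ.dilRep) b).trans hb)
    · intro M hM
      -- Testing on `a ⊗ p`, of norm at most `‖a‖` and with image of norm `‖φ a‖`, shows that a
      -- bound for `φ ⊗ id` on the unit ball is one for `φ`. Then `‖V ⊗ 1‖ ≤ ‖V‖` finishes.
      have h1 : ‖φ.dilOp‖ ^ 2 ≤ M := by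
        refine φ.isMinimalStinespring_dilRep.norm_sq.2 ?_
        rintro _ ⟨a, ha, rfl⟩
        refine hM ⟨CStarTensor.tmul a (compactRankOne e e), ?_, ?_⟩
        · refine (CStarTensor.norm_tmul_le _ _).trans ?_
          rwa [norm_compactRankOne, he, one_mul, mul_one]
        · rw [stabilization_tmul, coe_compactRankOne, HTensor.norm_map_rankOne he]
      exact (pow_le_pow_left₀ (norm_nonneg _) (norm_stabilizationOp_le φ) 2).trans h1
  minimal := span_tensorRep_stabilizationOp φ he

theorem IsMinimalStinespring.isNondegenerate {L : Type*} [NormedAddCommGroup L]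
    [InnerProductSpace ℂ L] [CompleteSpace L] {φ : A →CP (H →L[ℂ] H)} {π : A →⋆ₙₐ[ℂ] (L →L[ℂ] L)}
    {V : H →L[ℂ] L} (h : IsMinimalStinespring φ π V) : IsNondegenerate π :=
  top_unique <| h.minimal.ge.trans <| Submodule.topologicalClosure_mono <| Submodule.span_mono <| by
    rintro _ ⟨a, ξ, rfl⟩
    exact ⟨a, V ξ, rfl⟩

end Stabilization

theorem cpStronglyMoritaEquivalent_stabilization {A : Type u} [NonUnitalCStarAlgebra A]
    [PartialOrder A] [StarOrderedRing A]
    {H : Type v} [NormedAddCommGroup H] [InnerProductSpace ℂ H] [CompleteSpace H]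
    {K : Type w} [NormedAddCommGroup K] [InnerProductSpace ℂ K] [CompleteSpace K]
    {e : K} (he : ‖e‖ = 1) (φ : A →CP (H →L[ℂ] H)) :
    CPStronglyMoritaEquivalent φ (stabilization K φ) :=
  ⟨φ.Dilation, inferInstance, inferInstance, inferInstance, φ.dilRep, φ.dilOp,
    HTensor φ.Dilation K, inferInstance, inferInstance, inferInstance, tensorRep K φ.dilRep,
    stabilizationOp K φ, φ.isMinimalStinespring_dilRep, isMinimalStinespring_stabilization φ he,
    cornerRow A e, inferInstance, inferInstance, inferInstance, cornerBimodule he,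
    cornerRep φ.dilRep e, isBimoduleRepresentation_cornerRep he φ.dilRep
      φ.isMinimalStinespring_dilRep.isNondegenerate
      (isMinimalStinespring_stabilization φ he).isNondegenerate⟩

theorem existsUnique_stabilization_and_equivalent {A : Type u} [NonUnitalCStarAlgebra A]
    [PartialOrder A] [StarOrderedRing A]
    {H : Type v} [NormedAddCommGroup H] [InnerProductSpace ℂ H] [CompleteSpace H]
    {K : Type w} [NormedAddCommGroup K] [InnerProductSpace ℂ K] [CompleteSpace K]
    {e : K} (he : ‖e‖ = 1) (φ : A →CP (H →L[ℂ] H)) :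
    (∃! Φ : CStarTensor A (compactOperators K) →CP (HTensor H K →L[ℂ] HTensor H K),
      ∀ a (k : compactOperators K),
        Φ (CStarTensor.tmul a k) = HTensor.map (φ a) (k : K →L[ℂ] K)) ∧
      ∀ Φ : CStarTensor A (compactOperators K) →CP (HTensor H K →L[ℂ] HTensor H K),
        (∀ a (k : compactOperators K),
          Φ (CStarTensor.tmul a k) = HTensor.map (φ a) (k : K →L[ℂ] K)) →
        CPStronglyMoritaEquivalent φ Φ :=
  ⟨⟨stabilization K φ, stabilization_tmul K φ, fun _ => eq_stabilization⟩, fun _ hΦ =>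
    eq_stabilization hΦ ▸ cpStronglyMoritaEquivalent_stabilization he φ⟩

end

theorem mainTheorem8 {A : Type u} [NonUnitalCStarAlgebra A] [PartialOrder A] [StarOrderedRing A]
    {H : Type v} [NormedAddCommGroup H] [InnerProductSpace ℂ H] [CompleteSpace H]
    {H₀ : Type w} [NormedAddCommGroup H₀] [InnerProductSpace ℂ H₀] [CompleteSpace H₀]
    [TopologicalSpace.SeparableSpace H₀] (hH₀ : ¬ FiniteDimensional ℂ H₀)
    (φ : A →CP (H →L[ℂ] H)) :
    (∃! Φ : CStarTensor A (compactOperators H₀) →CP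
        (HilbertTensor H H₀ →L[ℂ] HilbertTensor H H₀), IsStabilization φ Φ) ∧
      ∀ Φ : CStarTensor A (compactOperators H₀) →CP
        (HilbertTensor H H₀ →L[ℂ] HilbertTensor H H₀),
        IsStabilization φ Φ → CPStronglyMoritaEquivalent φ Φ := by
  -- The construction asks only for a unit vector of `H₀`.
  have : Nontrivial H₀ := by
    by_contra h
    rw [not_nontrivial_iff_subsingleton] at h
    exact hH₀ inferInstance
  obtain ⟨e, he⟩ := exists_norm_eq H₀ (zero_le_one (α := ℝ))
  -- `HTensor` and `HilbertTensor` agree by definition, and so do `HTensor.map` and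
  -- `HilbertTensor.mapL`.
  exact existsUnique_stabilization_and_equivalent he φ
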